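/- Let $I=[\xi,\eta]$ with $\xi<\eta$, and let $a:I\to\mathbb{R}$ satisfy $a(x)\ge a_0>0$ on $I$. Let $G\subset\mathbb{C}$ be an open set containing $I$, and suppose that $i\sqrt a$ extends to a bounded holomorphic function $s$ on $G$. For $\sigma\in\{+,-\}$ define functions $(S_n^\sigma)'$ on $I$ by $(S_0^{\pm})'=\pm i\sqrt a$ and $$(S_n^{\sigma})'=-\frac{1}{2(S_0^{\sigma})'}\Big(\sum_{j=1}^{n-1}(S_j^{\sigma})'(S_{n-j}^{\sigma})'+(S_{n-1}^{\sigma})''\Big),\quad n\ge 1,$$ and put $S_n^{\sigma}(x)=\int_\xi^x (S_n^{\sigma})'(\tau)\,d\tau$. For $\varepsilon>0$, $N\in\mathbb{N}_0$ and $\varphi_0,\varphi_1\in\mathbb{C}$ let $$\varphi_N^{WKB}=\alpha_{N,\varepsilon}\exp\Big(\sum_{n=0}^N\varepsilon^{n-1}S_n^-\Big)+\beta_{N,\varepsilon}\exp\Big(\sum_{n=0}^N\varepsilon^{n-1}S_n^+\Big),$$ $$\alpha_{N,\varepsilon}=\frac{\varphi_0\sum_{n=0}^N\varepsilon^n(S_n^+)'(\xi)-\varphi_1}{D_{N,\varepsilon}},\quad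 \beta_{N,\varepsilon}=\frac{\varphi_1-\varphi_0\sum_{n=0}^N\varepsilon^n(S_n^-)'(\xi)}{D_{N,\varepsilon}},\quad D_{N,\varepsilon}=\sum_{n=0}^N\varepsilon^n\big((S_n^+)'(\xi)-(S_n^-)'(\xi)\big),$$ which is defined whenever $D_{N,\varepsilon}\ne 0$. Call constants $K_1,K_2>0$ admissible if, for both signs and all $n\in\mathbb{N}_0$, $k\ge 1$ (with $0^0=1$), $$\|S_n\|_{L^\infty(I)}\le(\eta-\xi)\|s\|_{L^\infty(G)}K_2^n n^n,\qquad \|S_n^{(k)}\|_{L^\infty(I)}\le\|s\|_{L^\infty(G)}(k-1)!\,K_1^{k-1}K_2^n n^n .$$ Then admissible constants exist. Moreover, for all admissible $K_1,K_2$ there is a function $N:(0,1)\to\{1,2,\dots\}$ with $D_{N(\varepsilon),\varepsilon}\neq0$ for all $\varepsilon\in(0,1)$, which is proportional to $1/\varepsilon$ up to rounding for small $\varepsilon$ (there are $\kappa>0$, $\varepsilon_0\in(0,1)$ with $N(\varepsilon)=\lfloor\kappa/\varepsilon\rfloor$ for $0<\varepsilon\le\varepsilon_0$), and there is $c>0$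 such that the following holds. For every $R$ there are constants $C_1,C_2,C_3>0$, independent of $\varepsilon$, such that for all $\varepsilon\in(0,1)$, all $\varphi_0,\varphi_1\in\mathbb{C}$ with $|\varphi_0|,|\varphi_1|\le R$, and the solution $\varphi$ of $$\varepsilon^2\varphi''+a\varphi=0\ \text{ on } I,\qquad \varphi(\xi)=\varphi_0,\quad \varepsilon\varphi'(\xi)=\varphi_1,$$ one has $$\|\varphi-\varphi_{N(\varepsilon)}^{WKB}\|_{L^\infty(I)}\le\frac{C_1}{\varepsilon}\exp\Big(-\frac{1}{eK_2\varepsilon}\Big)+\frac{C_2}{\varepsilon^2}\exp\Big(-\frac{\ln(e/2)}{eK_2\varepsilon}\Big),$$ and the optimally truncated error satisfies $$\inf_{N\in\mathbb{N}_0,\ D_{N,\varepsilon}\ne0}\|\varphi-\varphi_N^{WKB}\|_{L^\infty(I)}\le\frac{C_3}{\varepsilon^2}\exp\Big(-\frac{c}{\varepsilon}\Big).$$ -/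

import Mathlib

open Set MeasureTheory
open scoped ENNReal

noncomputable section

namespace WKB

/-- The norm of `L^∞(D)` (essential supremum with respect to Lebesgue measure), with values
in `[0, ∞]`. -/
def linftyNorm {X : Type*} [MeasureSpace X] (f : X → ℂ) (D : Set X) : ℝ≥0∞ :=
  eLpNorm f ∞ (volume.restrict D)

/-- The functions `S_n'` on `[ξ, η]` produced by the WKB recursion from `S_0' = s`:
`S_n' = -(1 / (2 S_0')) (∑_{j=1}^{n-1} S_j' S_{n-j}' + S_{n-1}'')` for `n ≥ 1`
(for `n = 1` the sum is empty). -/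
def dS (ξ η : ℝ) (s : ℝ → ℂ) : ℕ → ℝ → ℂ
  | 0 => s
  | n + 1 => fun x =>
      -(1 / (2 * s x)) *
        ((∑ j : Fin n, dS ξ η s (j.1 + 1) x * dS ξ η s (n - j.1) x)
          + derivWithin (dS ξ η s n) (Icc ξ η) x)
  termination_by n => n
  decreasing_by all_goals omega

theorem dS_zero (ξ η : ℝ) (s : ℝ → ℂ) : dS ξ η s 0 = s := by
  rw [dS]

theorem dS_succ (ξ η : ℝ) (s : ℝ → ℂ) (n : ℕ) (x : ℝ) :
    dS ξ η s (n + 1) x = -(1 / (2 * s x)) *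
      ((∑ j ∈ Finset.Icc 1 n, dS ξ η s j x * dS ξ η s (n + 1 - j) x)
        + derivWithin (dS ξ η s n) (Icc ξ η) x) := by
  rw [dS]
  beta_reduce
  rw [Fin.sum_univ_eq_sum_range (fun j => dS ξ η s (j + 1) x * dS ξ η s (n - j) x) n,
    Finset.range_eq_Ico,
    show Finset.Icc 1 n = Finset.Ico (0 + 1) (n + 1) by ext; simp,
    ← Finset.sum_Ico_add' (fun j => dS ξ η s j x * dS ξ η s (n + 1 - j) x) 0 n 1]
  simp only [Nat.add_sub_add_right]

/-- `S_0' = ± i √a`, the sign being `σ`. -/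
def s0 (a : ℝ → ℝ) (σ : ℤˣ) (x : ℝ) : ℂ :=
  ((σ : ℤ) : ℂ) * (Complex.I * (Real.sqrt (a x) : ℂ))

/-- The derivatives `(S_n^±)'`, the sign being `σ`. -/
def dSpm (ξ η : ℝ) (a : ℝ → ℝ) (σ : ℤˣ) (n : ℕ) : ℝ → ℂ :=
  dS ξ η (s0 a σ) n

/-- `S_n^±(x) = ∫_ξ^x (S_n^±)'(τ) dτ`, the sign being `σ`. -/
def Spm (ξ η : ℝ) (a : ℝ → ℝ) (σ : ℤˣ) (n : ℕ) (x : ℝ) : ℂ :=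
  ∫ τ in ξ..x, dSpm ξ η a σ n τ

/-- `∑_{n=0}^N ε^n (S_n^±)'(ξ)`. -/
def slopeSum (ξ η : ℝ) (a : ℝ → ℝ) (ε : ℝ) (N : ℕ) (σ : ℤˣ) : ℂ :=
  ∑ n ∈ Finset.range (N + 1), (ε : ℂ) ^ n * dSpm ξ η a σ n ξ

/-- The common denominator `∑_{n=0}^N ε^n ((S_n^+)'(ξ) - (S_n^-)'(ξ))` of `α_{N,ε}` and
`β_{N,ε}`. -/
def denom (ξ η : ℝ) (a : ℝ → ℝ) (ε : ℝ) (N : ℕ) : ℂ :=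
  ∑ n ∈ Finset.range (N + 1), (ε : ℂ) ^ n * (dSpm ξ η a 1 n ξ - dSpm ξ η a (-1) n ξ)

/-- The coefficient `α_{N,ε}`. -/
def alpha (ξ η : ℝ) (a : ℝ → ℝ) (ε : ℝ) (φ₀ φ₁ : ℂ) (N : ℕ) : ℂ :=
  (φ₀ * slopeSum ξ η a ε N 1 - φ₁) / denom ξ η a ε N

/-- The coefficient `β_{N,ε}`. -/
def beta (ξ η : ℝ) (a : ℝ → ℝ) (ε : ℝ) (φ₀ φ₁ : ℂ) (N : ℕ) : ℂ :=
  (φ₁ - φ₀ * slopeSum ξ η a ε N (-1)) / denom ξ η a ε N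

/-- The truncated WKB series `∑_{n=0}^N ε^{n-1} S_n^±(x)`. -/
def expo (ξ η : ℝ) (a : ℝ → ℝ) (ε : ℝ) (N : ℕ) (σ : ℤˣ) (x : ℝ) : ℂ :=
  ∑ n ∈ Finset.range (N + 1), (ε : ℂ) ^ ((n : ℤ) - 1) * Spm ξ η a σ n x

/-- The WKB approximation `φ_N^{WKB}`; it is well defined when `denom ξ η a ε N ≠ 0`. -/
def phiWKB (ξ η : ℝ) (a : ℝ → ℝ) (ε : ℝ) (φ₀ φ₁ : ℂ) (N : ℕ) (x : ℝ) : ℂ :=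
  alpha ξ η a ε φ₀ φ₁ N * Complex.exp (expo ξ η a ε N (-1) x)
    + beta ξ η a ε φ₀ φ₁ N * Complex.exp (expo ξ η a ε N 1 x)

/-- `φ` is a (classical) solution on `[ξ, η]` of `ε² φ'' + a φ = 0`, `φ(ξ) = φ₀`,
`ε φ'(ξ) = φ₁`. -/
structure IsSolution (ξ η : ℝ) (a : ℝ → ℝ) (ε : ℝ) (φ₀ φ₁ : ℂ) (φ : ℝ → ℂ) : Prop where
  contDiffOn : ContDiffOn ℝ 2 φ (Icc ξ η)
  ode : ∀ x ∈ Icc ξ η,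
    (ε : ℂ) ^ 2 * iteratedDerivWithin 2 φ (Icc ξ η) x + (a x : ℂ) * φ x = 0
  init : φ ξ = φ₀
  init_deriv : (ε : ℂ) * derivWithin φ (Icc ξ η) ξ = φ₁

/-- `‖φ - φ_N^{WKB}‖_{L^∞(I)}`. -/
def error (ξ η : ℝ) (a : ℝ → ℝ) (ε : ℝ) (φ₀ φ₁ : ℂ) (φ : ℝ → ℂ) (N : ℕ) : ℝ≥0∞ :=
  linftyNorm (fun x => φ x - phiWKB ξ η a ε φ₀ φ₁ N x) (Icc ξ η)

/-- The error under optimal truncation: the infimum of the errors over all truncation orders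
for which the WKB approximation is defined (the error at `N_opt`, whenever a minimizer `N_opt`
exists). -/
def optimalError (ξ η : ℝ) (a : ℝ → ℝ) (ε : ℝ) (φ₀ φ₁ : ℂ) (φ : ℝ → ℂ) : ℝ≥0∞ :=
  ⨅ (N : ℕ) (_ : denom ξ η a ε N ≠ 0), error ξ η a ε φ₀ φ₁ φ N

/-- `K₁, K₂ > 0` are admissible constants in the estimates, for both signs and all `n ≥ 0`,
`‖S_n‖_{L^∞(I)} ≤ (η - ξ) M K₂^n n^n` and
`‖S_n^{(k)}‖_{L^∞(I)} ≤ M (k-1)! K₁^{k-1} K₂^n n^n` for `k ≥ 1`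
(with `0^0 = 1`), where `M` stands for `‖S_0'‖_{L^∞(G)}`. -/
structure SeriesBounds (ξ η : ℝ) (a : ℝ → ℝ) (M : ℝ≥0∞) (K₁ K₂ : ℝ) : Prop where
  pos₁ : 0 < K₁
  pos₂ : 0 < K₂
  bound : ∀ (σ : ℤˣ) (n : ℕ),
    linftyNorm (Spm ξ η a σ n) (Icc ξ η)
      ≤ ENNReal.ofReal (η - ξ) * M * ENNReal.ofReal (K₂ ^ n * (n : ℝ) ^ n)
  bound_deriv : ∀ (σ : ℤˣ) (n k : ℕ), 1 ≤ k →
    linftyNorm (iteratedDerivWithin k (Spm ξ η a σ n) (Icc ξ η)) (Icc ξ η)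
      ≤ M * ENNReal.ofReal
          (((k - 1).factorial : ℝ) * K₁ ^ (k - 1) * K₂ ^ n * (n : ℝ) ^ n)

end WKB

end

noncomputable section

namespace WKB

/-! ### Pointwise bounds and `L^∞` bounds -/

/-! Admissible constants come from Cauchy estimates. The recursion makes sense for the holomorphic
extension of `S_0'` near `I`, where `|S_0'|` stays bounded below. Each differentiation costs some
width of the neighbourhood; distributing the loss well gives `|S_n'| ≤ m K ^ n n! / ρ ^ n` at
distance `ρ` inside (`norm_cdS_le`), and `n! ≤ n ^ n`.

For the error, `φ - φ_N` has zero Cauchy data at `ξ` by the choice of `α` and `β`. An energy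
estimate with constants uniform in `ε` bounds it by the residual divided by `ε` (`energy_estimate`).
The recursion cancels every order up to `N` in the residual of the truncated series, leaving a
derivative term and the products with `j + k > N` (`wkb_residual`). If `ε K₂ N ≤ 1 / e`, the
admissible bounds give `|ε ^ n S_n'| ≤ M e ^ (-n)` for `n ≤ N`, so the residual is at most a
constant times `(N + 1) ^ 2 e ^ (-N)`.

The other factors stay bounded: `S_0` is purely imaginary, so the exponentials are controlled by the
orders `n ≥ 1`, and `D_{N,ε}` is close to `2 i √a(ξ)`. With `N = ⌊1 / (e K₂ ε)⌋` one power of `1 /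
ε` is traded for the weaker rate `ln (e / 2)`. For `ε` away from zero the order `N = 1` suffices. -/

theorem linftyNorm_le_of_forall {X : Type*} [MeasureSpace X] {f : X → ℂ} {D : Set X}
    (hD : MeasurableSet D) {C : ℝ} (h : ∀ x ∈ D, ‖f x‖ ≤ C) :
    linftyNorm f D ≤ ENNReal.ofReal C := by
  rw [linftyNorm, eLpNorm_exponent_top]
  exact eLpNormEssSup_le_of_ae_bound ((ae_restrict_iff' hD).2 (.of_forall h))

/-- The inequality is phrased as an a.e. equality with a maximum, since a.e. equal continuous
functions agree everywhere; this upgrades essential bounds to pointwise ones. -/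
theorem ae_norm_le_of_linftyNorm_le {X : Type*} [MeasureSpace X] {f : X → ℂ} {D : Set X}
    {C : ℝ} (hC : 0 ≤ C) (h : linftyNorm f D ≤ ENNReal.ofReal C) :
    (fun x => max ‖f x‖ C) =ᵐ[volume.restrict D] fun _ => C := by
  rw [linftyNorm, eLpNorm_exponent_top] at h
  filter_upwards [ae_le_eLpNormEssSup (f := f) (μ := volume.restrict D)] with x hx
  have := hx.trans h
  rw [← ofReal_norm, ENNReal.ofReal_le_ofReal_iff hC] at this
  exact max_eq_right this

theorem norm_le_of_linftyNorm_le_Icc {f : ℝ → ℂ} {ξ η : ℝ} (hξη : ξ < η)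
    (hf : ContinuousOn f (Icc ξ η)) {C : ℝ} (hC : 0 ≤ C)
    (h : linftyNorm f (Icc ξ η) ≤ ENNReal.ofReal C) : ∀ x ∈ Icc ξ η, ‖f x‖ ≤ C := by
  intro x hx
  have := Measure.eqOn_Icc_of_ae_eq volume hξη.ne (ae_norm_le_of_linftyNorm_le hC h)
    (hf.norm.sup continuousOn_const) continuousOn_const hx
  exact max_eq_right_iff.1 this

theorem norm_le_toReal_linftyNorm {f : ℂ → ℂ} {G : Set ℂ} (hG : IsOpen G)
    (hf : ContinuousOn f G) (h : linftyNorm f G < ⊤) :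
    ∀ z ∈ G, ‖f z‖ ≤ (linftyNorm f G).toReal := by
  intro z hz
  have := Measure.eqOn_open_of_ae_eq
    (ae_norm_le_of_linftyNorm_le ENNReal.toReal_nonneg (ENNReal.ofReal_toReal h.ne).ge) hG
    (hf.norm.sup continuousOn_const) continuousOn_const hz
  exact max_eq_right_iff.1 this

/-! ### The WKB recursion in the complex domain -/

/-- The WKB recursion for holomorphic functions. -/
def cdS (s : ℂ → ℂ) : ℕ → ℂ → ℂ
  | 0 => s
  | n + 1 => fun z =>
      -(1 / (2 * s z)) *
        ((∑ j : Fin n, cdS s (j.1 + 1) z * cdS s (n - j.1) z) + deriv (cdS s n) z)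
  termination_by n => n
  decreasing_by all_goals omega

theorem cdS_zero (s : ℂ → ℂ) : cdS s 0 = s := by
  rw [cdS]

theorem cdS_succ (s : ℂ → ℂ) (n : ℕ) (z : ℂ) :
    cdS s (n + 1) z = -(1 / (2 * s z)) *
      ((∑ j ∈ Finset.Icc 1 n, cdS s j z * cdS s (n + 1 - j) z) + deriv (cdS s n) z) := by
  rw [cdS]
  beta_reduce
  rw [Fin.sum_univ_eq_sum_range (fun j => cdS s (j + 1) z * cdS s (n - j) z) n,
    Finset.range_eq_Ico,
    show Finset.Icc 1 n = Finset.Ico (0 + 1) (n + 1) by ext; simp,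
    ← Finset.sum_Ico_add' (fun j => cdS s j z * cdS s (n + 1 - j) z) 0 n 1]
  simp only [Nat.add_sub_add_right]

theorem differentiableOn_cdS {s : ℂ → ℂ} {U : Set ℂ} (hU : IsOpen U)
    (hs : DifferentiableOn ℂ s U) (h0 : ∀ z ∈ U, s z ≠ 0) (n : ℕ) :
    DifferentiableOn ℂ (cdS s n) U := by
  induction n using Nat.strong_induction_on with
  | _ n ih =>
    rcases n with _ | n
    · rwa [cdS_zero]
    · rw [funext (cdS_succ s n)]
      have h1 : DifferentiableOn ℂ (fun z => -(1 / (2 * s z))) U :=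
        ((differentiableOn_const 1).div (hs.const_mul 2)
          fun z hz => mul_ne_zero two_ne_zero (h0 z hz)).neg
      refine h1.mul (DifferentiableOn.add ?_ ((ih n n.lt_succ_self).deriv hU))
      refine DifferentiableOn.fun_sum fun j hj => ?_
      rw [Finset.mem_Icc] at hj
      exact (ih j (by omega)).mul (ih _ (by omega))

theorem norm_deriv_le_of_thickening {f : ℂ → ℂ} {T : Set ℂ} {r r' C : ℝ} (hr : r' < r)
    (hf : DifferentiableOn ℂ f (Metric.thickening r T))
    (hC : ∀ z ∈ Metric.thickening r T, ‖f z‖ ≤ C) :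
    ∀ z ∈ Metric.thickening r' T, ‖deriv f z‖ ≤ C / (r - r') := by
  intro z hz
  have hsub : Metric.closedBall z (r - r') ⊆ Metric.thickening r T := by
    intro w hw
    obtain ⟨x, hx, hzx⟩ := Metric.mem_thickening_iff.1 hz
    refine Metric.mem_thickening_iff.2 ⟨x, hx, ?_⟩
    have := dist_triangle w z x
    rw [Metric.mem_closedBall] at hw
    linarith
  refine Complex.norm_deriv_le_of_forall_mem_sphere_norm_le (sub_pos.2 hr)
    (hf.diffContOnCl_ball hsub) fun w hw => hC w (hsub (Metric.sphere_subset_closedBall hw))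

theorem factorial_succ_mul_factorial_succ_le (i l : ℕ) :
    (i + 1).factorial * (l + 1).factorial ≤ (i + l + 1).factorial := by
  induction l with
  | zero => simp
  | succ l ih =>
    rw [Nat.factorial_succ (l + 1), Nat.mul_left_comm, ← add_assoc, Nat.factorial_succ (i + l + 1)]
    exact Nat.mul_le_mul (by omega) ih

/-- Both indices are at least 1, so each of the `n` products is at most `n!`. The quadratic part of
the recursion therefore costs no extra growth. -/
theorem sum_factorial_mul_factorial_le (n : ℕ) :
    ∑ j ∈ Finset.Icc 1 n, (j.factorial : ℝ) * ((n + 1 - j).factorial : ℝ)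
      ≤ ((n + 1).factorial : ℝ) := by
  have : ∀ j ∈ Finset.Icc 1 n, (j.factorial : ℝ) * ((n + 1 - j).factorial : ℝ) ≤ n.factorial := by
    intro j hj
    rw [Finset.mem_Icc] at hj
    obtain ⟨i, rfl⟩ : ∃ i, j = i + 1 := ⟨j - 1, by omega⟩
    obtain ⟨l, rfl⟩ : ∃ l, n = i + l + 1 := ⟨n - i - 1, by omega⟩
    rw [show i + l + 1 + 1 - (i + 1) = l + 1 by omega]
    exact_mod_cast factorial_succ_mul_factorial_succ_le i l
  refine (Finset.sum_le_sum this).trans ?_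
  rw [Finset.sum_const, Nat.card_Icc, nsmul_eq_mul, Nat.factorial_succ, add_tsub_cancel_right]
  push_cast
  gcongr
  linarith

theorem one_add_inv_pow_le_three (n : ℕ) : (((n + 1 : ℕ) : ℝ) / n) ^ n ≤ 3 := by
  rcases n.eq_zero_or_pos with rfl | hn
  · norm_num
  have hn' : (0 : ℝ) < n := by exact_mod_cast hn
  have h1 : ((n + 1 : ℕ) : ℝ) / n ≤ Real.exp (1 / n) := by
    have := Real.add_one_le_exp (1 / (n : ℝ))
    push_cast
    rwa [add_div, div_self hn'.ne', add_comm]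
  calc (((n + 1 : ℕ) : ℝ) / n) ^ n ≤ Real.exp (1 / n) ^ n := by gcongr
    _ = Real.exp 1 := by
      rw [← Real.exp_nat_mul]
      congr 1
      field_simp
    _ ≤ 3 := Real.exp_one_lt_three.le

/-- The bound is proved for all `ρ` at once, so that the derivative at depth `ρ` can be estimated
from the previous bound at a smaller depth. The condition `M ≤ K * (2 * m ^ 2)` serves the first
step, `3 ≤ K * m` all later ones. -/
theorem norm_cdS_le {s : ℂ → ℂ} {T : Set ℂ} {δ m M K : ℝ} (hm : 0 < m)
    (hs : DifferentiableOn ℂ s (Metric.thickening δ T))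
    (hsm : ∀ z ∈ Metric.thickening δ T, m ≤ ‖s z‖)
    (hsM : ∀ z ∈ Metric.thickening δ T, ‖s z‖ ≤ M)
    (hK : 0 < K) (hK1 : 3 ≤ K * m) (hK2 : M ≤ K * (2 * m ^ 2)) (n : ℕ) :
    ∀ ρ : ℝ, 0 < ρ → ∀ z ∈ Metric.thickening (δ - ρ) T,
      ‖cdS s (n + 1) z‖ ≤ m * K ^ (n + 1) * (n + 1).factorial / ρ ^ (n + 1) := by
  have h0 : ∀ z ∈ Metric.thickening δ T, s z ≠ 0 := fun z hz h => by
    have := hsm z hz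
    rw [h, norm_zero] at this
    linarith
  have hdiff := differentiableOn_cdS Metric.isOpen_thickening hs h0
  have hmono : ∀ ρ : ℝ, 0 < ρ → Metric.thickening (δ - ρ) T ⊆ Metric.thickening δ T :=
    fun ρ hρ => Metric.thickening_mono (by linarith) T
  induction n using Nat.strong_induction_on with
  | _ n ih =>
    intro ρ hρ z hz
    have hzδ := hmono ρ hρ hz
    have hsz := hsm z hzδ
    rw [cdS_succ, norm_mul, norm_neg, norm_div, norm_one, norm_mul, Complex.norm_ofNat]
    have hfac : 1 / (2 * ‖s z‖) ≤ 1 / (2 * m) := by gcongr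
    rcases n with _ | n
    · have hd := norm_deriv_le_of_thickening (r := δ) (r' := δ - ρ) (by linarith) hs hsM z hz
      simp only [zero_add, Finset.Icc_eq_empty_of_lt zero_lt_one, Finset.sum_empty, cdS_zero,
        pow_one, Nat.factorial_one, Nat.cast_one, mul_one]
      rw [sub_sub_cancel] at hd
      calc 1 / (2 * ‖s z‖) * ‖deriv s z‖ ≤ 1 / (2 * m) * (M / ρ) := by gcongr
        _ ≤ 1 / (2 * m) * (K * (2 * m ^ 2) / ρ) := by gcongr
        _ = m * K / ρ := by field_simp
    · have hn : (0 : ℝ) < ((n + 1 : ℕ) : ℝ) := by positivity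
      have hn2 : (0 : ℝ) < ((n + 2 : ℕ) : ℝ) := by positivity
      -- This depth gives Cauchy discs of radius `ρ / (n + 2)`: the derivative costs the factor `n +
      -- 2` needed for the factorial, and replacing `ρ'` by `ρ` costs only `((n + 2) / (n + 1)) ^ (n
      -- + 1) ≤ 3`.
      set ρ' := ρ * ((n + 1 : ℕ) : ℝ) / ((n + 2 : ℕ) : ℝ) with hρ'
      have hρ'0 : 0 < ρ' := by positivity
      have hρρ' : ρ - ρ' = ρ / ((n + 2 : ℕ) : ℝ) := by
        rw [hρ']
        field_simp
        push_cast
        ring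
      have hpos : 0 < ρ / ((n + 2 : ℕ) : ℝ) := by positivity
      have hd := norm_deriv_le_of_thickening (r := δ - ρ') (r' := δ - ρ) (by linarith)
        ((hdiff (n + 1)).mono (hmono ρ' hρ'0)) (ih n n.lt_succ_self ρ' hρ'0) z hz
      rw [show δ - ρ' - (δ - ρ) = ρ / ((n + 2 : ℕ) : ℝ) by rw [← hρρ']; ring] at hd
      set X : ℝ := K ^ (n + 2) * (n + 2).factorial / ρ ^ (n + 2) with hX
      have hX0 : 0 ≤ X := by positivity
      have hd' : ‖deriv (cdS s (n + 1)) z‖ ≤ m * 3 / K * X := by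
        refine hd.trans ?_
        have h3 := one_add_inv_pow_le_three (n + 1)
        have : m * K ^ (n + 1) * ((n + 1).factorial : ℝ) / ρ' ^ (n + 1) / (ρ / ((n + 2 : ℕ) : ℝ))
            = m / K * X * (((n + 1 + 1 : ℕ) : ℝ) / ((n + 1 : ℕ) : ℝ)) ^ (n + 1) := by
          rw [hX, hρ', Nat.factorial_succ (n + 1), div_pow, div_pow, mul_pow]
          push_cast
          field_simp
          ring
        rw [this]
        calc _ ≤ m / K * X * 3 := by gcongr
          _ = _ := by ring
      have hsum : ‖∑ j ∈ Finset.Icc 1 (n + 1), cdS s j z * cdS s (n + 1 + 1 - j) z‖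
          ≤ m ^ 2 * X := by
        calc _ ≤ ∑ j ∈ Finset.Icc 1 (n + 1), m ^ 2 * K ^ (n + 2) / ρ ^ (n + 2) *
              ((j.factorial : ℝ) * ((n + 1 + 1 - j).factorial : ℝ)) := by
              refine norm_sum_le_of_le _ fun j hj => ?_
              rw [Finset.mem_Icc] at hj
              obtain ⟨i, rfl⟩ : ∃ i, j = i + 1 := ⟨j - 1, by omega⟩
              obtain ⟨l, hl⟩ : ∃ l, n + 1 + 1 - (i + 1) = l + 1 := ⟨n - i, by omega⟩
              have h1 := ih i (by omega) ρ hρ z hz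
              have h2 := ih l (by omega) ρ hρ z hz
              rw [hl, norm_mul, show n + 2 = (i + 1) + (l + 1) by omega]
              calc _ ≤ (m * K ^ (i + 1) * (i + 1).factorial / ρ ^ (i + 1)) *
                    (m * K ^ (l + 1) * (l + 1).factorial / ρ ^ (l + 1)) := by gcongr
                _ = _ := by
                  rw [pow_add K (i + 1), pow_add ρ (i + 1)]
                  ring
          _ ≤ m ^ 2 * K ^ (n + 2) / ρ ^ (n + 2) * ((n + 1 + 1).factorial : ℝ) := by
              rw [← Finset.mul_sum]
              gcongr
              exact sum_factorial_mul_factorial_le (n + 1)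
          _ = _ := by rw [hX]; ring
      calc _ ≤ 1 / (2 * m) * (m ^ 2 * X + m * 3 / K * X) := by
              gcongr
              exact norm_add_le_of_le hsum hd'
        _ = (m + 3 / K) / 2 * X := by field_simp
        _ ≤ (m + m) / 2 * X := by
              gcongr
              rwa [div_le_iff₀ hK, mul_comm]
        _ = _ := by rw [hX]; ring

/-! ### From the complex domain to the interval -/

theorem exists_thickening_norm_ge {T G : Set ℂ} (hT : IsCompact T) (hG : IsOpen G)
    (hTG : T ⊆ G) {s : ℂ → ℂ} (hs : ContinuousOn s G) {m : ℝ} (hm : ∀ z ∈ T, m < ‖s z‖) :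
    ∃ δ > 0, Metric.thickening δ T ⊆ G ∧ ∀ z ∈ Metric.thickening δ T, m ≤ ‖s z‖ := by
  obtain ⟨δ, hδ, hsub⟩ := hT.exists_thickening_subset_open
    (hs.norm.isOpen_inter_preimage hG (isOpen_Ioi (a := m))) fun z hz => ⟨hTG hz, hm z hz⟩
  exact ⟨δ, hδ, fun z hz => (hsub hz).1, fun z hz => (hsub hz).2.le⟩

/-- A complex derivative restricts to the derivative along the real interval, so the two recursions
stay equal on it. -/
theorem dS_eqOn_cdS {ξ η : ℝ} (hξη : ξ < η) {s : ℝ → ℂ} {S : ℂ → ℂ} {U : Set ℂ}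
    (hU : IsOpen U) (hIU : ∀ x ∈ Icc ξ η, (x : ℂ) ∈ U) (hS : DifferentiableOn ℂ S U)
    (h0 : ∀ z ∈ U, S z ≠ 0) (hsS : ∀ x ∈ Icc ξ η, s x = S x) (n : ℕ) :
    ∀ x ∈ Icc ξ η, dS ξ η s n x = cdS S n x := by
  induction n using Nat.strong_induction_on with
  | _ n ih =>
    intro x hx
    rcases n with _ | n
    · rw [dS_zero, cdS_zero, hsS x hx]
    · have hd : HasDerivWithinAt (dS ξ η s n) (deriv (cdS S n) x) (Icc ξ η) x :=
        ((differentiableOn_cdS hU hS h0 n).differentiableAt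
          (hU.mem_nhds (hIU x hx))).hasDerivAt.comp_ofReal.hasDerivWithinAt.congr
          (fun y hy => ih n n.lt_succ_self y hy) (ih n n.lt_succ_self x hx)
      rw [dS_succ, cdS_succ, hsS x hx, hd.derivWithin (uniqueDiffOn_Icc hξη x hx)]
      congr 2
      refine Finset.sum_congr rfl fun j hj => ?_
      rw [Finset.mem_Icc] at hj
      rw [ih j (by omega) x hx, ih (n + 1 - j) (by omega) x hx]

theorem s0_eq {a : ℝ → ℝ} {s : ℂ → ℂ} {ξ η : ℝ}
    (hsI : ∀ x ∈ Icc ξ η, s (x : ℂ) = Complex.I * (Real.sqrt (a x) : ℂ)) (σ : ℤˣ) :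
    ∀ x ∈ Icc ξ η, s0 a σ x = ((σ : ℤ) : ℂ) * s x := by
  intro x hx
  rw [s0, hsI x hx]

theorem norm_intUnit_mul (σ : ℤˣ) (z : ℂ) : ‖((σ : ℤ) : ℂ) * z‖ = ‖z‖ := by
  rcases Int.units_eq_one_or σ with rfl | rfl <;> simp

theorem contDiffOn_of_eqOn {ξ η : ℝ} {f : ℝ → ℂ} {F : ℂ → ℂ} {U : Set ℂ} (hU : IsOpen U)
    (hIU : ∀ x ∈ Icc ξ η, (x : ℂ) ∈ U) (hF : DifferentiableOn ℂ F U)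
    (h : ∀ x ∈ Icc ξ η, f x = F x) : ContDiffOn ℝ 1 f (Icc ξ η) := by
  have h1 : ContDiffOn ℝ 1 F U := (hF.contDiffOn (n := 1) hU).restrict_scalars ℝ
  exact (h1.comp Complex.ofRealCLM.contDiff.contDiffOn hIU).congr h

theorem hasDerivWithinAt_integral_Icc {ξ η : ℝ} {f : ℝ → ℂ} (hf : ContinuousOn f (Icc ξ η)) :
    ∀ x ∈ Icc ξ η, HasDerivWithinAt (fun u => ∫ τ in ξ..u, f τ) (f x) (Icc ξ η) x := by
  intro x hx
  -- Supplies the instance that lets the fundamental theorem of calculus run within `Icc ξ η`,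
  -- endpoints included.
  have : Fact (x ∈ Icc ξ η) := ⟨hx⟩
  refine intervalIntegral.integral_hasDerivWithinAt_right ?_
    (hf.stronglyMeasurableAtFilter_nhdsWithin measurableSet_Icc x) (hf x hx)
  refine (hf.mono ?_).intervalIntegrable
  rw [uIcc_of_le hx.1]
  exact Icc_subset_Icc_right hx.2

theorem iteratedDerivWithin_succ_integral {ξ η : ℝ} (hξη : ξ < η) {f : ℝ → ℂ} {F : ℂ → ℂ}
    {U : Set ℂ} (hU : IsOpen U) (hIU : ∀ x ∈ Icc ξ η, (x : ℂ) ∈ U)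
    (hF : DifferentiableOn ℂ F U) (h : ∀ x ∈ Icc ξ η, f x = F x) (k : ℕ) :
    ∀ x ∈ Icc ξ η, iteratedDerivWithin (k + 1) (fun u => ∫ τ in ξ..u, f τ) (Icc ξ η) x
      = iteratedDeriv k F x := by
  have hdiff : ∀ k, DifferentiableOn ℂ (iteratedDeriv k F) U := by
    intro k
    induction k with
    | zero => rwa [iteratedDeriv_zero]
    | succ k ih => rw [iteratedDeriv_succ]; exact ih.deriv hU
  induction k with
  | zero =>
    intro x hx
    rw [zero_add, iteratedDerivWithin_one, iteratedDeriv_zero, ← h x hx]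
    exact (hasDerivWithinAt_integral_Icc
      (contDiffOn_of_eqOn hU hIU hF h).continuousOn x hx).derivWithin (uniqueDiffOn_Icc hξη x hx)
  | succ k ih =>
    intro x hx
    rw [iteratedDerivWithin_succ, iteratedDeriv_succ]
    exact (((hdiff k).differentiableAt
      (hU.mem_nhds (hIU x hx))).hasDerivAt.comp_ofReal.hasDerivWithinAt.congr
      (fun y hy => ih y hy) (ih x hx)).derivWithin (uniqueDiffOn_Icc hξη x hx)

section Extension

variable {ξ η : ℝ} {a : ℝ → ℝ} {U : Set ℂ} {s : ℂ → ℂ}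

theorem dSpm_eq_cdS (hξη : ξ < η) (hU : IsOpen U) (hIU : ∀ x ∈ Icc ξ η, (x : ℂ) ∈ U)
    (hs : DifferentiableOn ℂ s U) (h0 : ∀ z ∈ U, s z ≠ 0)
    (hsI : ∀ x ∈ Icc ξ η, s (x : ℂ) = Complex.I * (Real.sqrt (a x) : ℂ)) (σ : ℤˣ) (n : ℕ) :
    ∀ x ∈ Icc ξ η, dSpm ξ η a σ n x = cdS (fun z => ((σ : ℤ) : ℂ) * s z) n x :=
  dS_eqOn_cdS hξη hU hIU (hs.const_mul _)
    (fun z hz => norm_ne_zero_iff.1 (by rw [norm_intUnit_mul]; exact norm_ne_zero_iff.2 (h0 z hz)))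
    (s0_eq hsI σ) n

theorem contDiffOn_dSpm (hξη : ξ < η) (hU : IsOpen U) (hIU : ∀ x ∈ Icc ξ η, (x : ℂ) ∈ U)
    (hs : DifferentiableOn ℂ s U) (h0 : ∀ z ∈ U, s z ≠ 0)
    (hsI : ∀ x ∈ Icc ξ η, s (x : ℂ) = Complex.I * (Real.sqrt (a x) : ℂ)) (σ : ℤˣ) (n : ℕ) :
    ContDiffOn ℝ 1 (dSpm ξ η a σ n) (Icc ξ η) :=
  contDiffOn_of_eqOn hU hIU (differentiableOn_cdS hU (hs.const_mul _)
    (fun z hz => norm_ne_zero_iff.1 (by rw [norm_intUnit_mul]; exact norm_ne_zero_iff.2 (h0 z hz)))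
    n) (dSpm_eq_cdS hξη hU hIU hs h0 hsI σ n)

theorem exists_seriesBounds (hξη : ξ < η) {δ m M : ℝ} (hδ : 0 < δ) (hm : 0 < m)
    (hs : DifferentiableOn ℂ s (Metric.thickening δ (Complex.ofReal '' Icc ξ η)))
    (hsm : ∀ z ∈ Metric.thickening δ (Complex.ofReal '' Icc ξ η), m ≤ ‖s z‖)
    (hsM : ∀ z ∈ Metric.thickening δ (Complex.ofReal '' Icc ξ η), ‖s z‖ ≤ M)
    (hsI : ∀ x ∈ Icc ξ η, s (x : ℂ) = Complex.I * (Real.sqrt (a x) : ℂ)) :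
    ∃ K₁ K₂ : ℝ, SeriesBounds ξ η a (ENNReal.ofReal M) K₁ K₂ := by
  set T := Complex.ofReal '' Icc ξ η with hT
  have hIT : ∀ x ∈ Icc ξ η, (x : ℂ) ∈ T := fun x hx => mem_image_of_mem _ hx
  have hIU : ∀ r > 0, ∀ x ∈ Icc ξ η, (x : ℂ) ∈ Metric.thickening r T :=
    fun r hr x hx => Metric.self_subset_thickening hr T (hIT x hx)
  have h0 : ∀ z ∈ Metric.thickening δ T, s z ≠ 0 := fun z hz h => by
    have := hsm z hz
    rw [h, norm_zero] at this
    linarith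
  have hξ := left_mem_Icc.2 hξη.le
  have hmM : m ≤ M := (hsm _ (hIU δ hδ ξ hξ)).trans (hsM _ (hIU δ hδ ξ hξ))
  have hM : 0 < M := hm.trans_le hmM
  -- The sum of the two thresholds that `norm_cdS_le` imposes on `K`.
  set K := 3 / m + M / (2 * m ^ 2) with hK
  have hK0 : 0 < K := by positivity
  have hK1 : 3 ≤ K * m := by
    rw [hK, add_mul, div_mul_cancel₀ _ hm.ne']
    have : 0 ≤ M / (2 * m ^ 2) * m := by positivity
    linarith
  have hK2 : M ≤ K * (2 * m ^ 2) := by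
    rw [hK, add_mul, div_mul_cancel₀ _ (by positivity)]
    have : 0 ≤ 3 / m * (2 * m ^ 2) := by positivity
    linarith
  -- This is `K / ρ` at depth `ρ = δ / 2`; the remaining half of the width is kept for the higher
  -- derivatives.
  set L := 2 * K / δ with hL
  have hL0 : 0 < L := by positivity
  have hc : ∀ (σ : ℤˣ) (n : ℕ), ∀ z ∈ Metric.thickening (δ - δ / 2) T,
      ‖cdS (fun z => ((σ : ℤ) : ℂ) * s z) n z‖ ≤ M * (L ^ n * (n : ℝ) ^ n) := by
    intro σ n z hz
    rcases n with _ | n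
    · have := hsM z (Metric.thickening_mono (by linarith) T hz)
      simpa only [cdS_zero, norm_intUnit_mul, pow_zero, mul_one] using this
    · refine (norm_cdS_le hm (hs.const_mul _) (by simpa only [norm_intUnit_mul] using hsm)
        (by simpa only [norm_intUnit_mul] using hsM) hK0 hK1 hK2 n (δ / 2) (by positivity) z hz).trans ?_
      have hf : ((n + 1).factorial : ℝ) ≤ ((n + 1 : ℕ) : ℝ) ^ (n + 1) := by
        exact_mod_cast Nat.factorial_le_pow (n + 1)
      calc m * K ^ (n + 1) * ((n + 1).factorial : ℝ) / (δ / 2) ^ (n + 1)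
          = m * (L ^ (n + 1) * ((n + 1).factorial : ℝ)) := by
            rw [hL, div_pow, div_pow, mul_pow]
            field_simp
        _ ≤ _ := by gcongr
  have heq := fun σ n => dSpm_eq_cdS hξη Metric.isOpen_thickening (hIU δ hδ) hs h0 hsI σ n
  have hdiff : ∀ (σ : ℤˣ) (n : ℕ),
      DifferentiableOn ℂ (cdS (fun z => ((σ : ℤ) : ℂ) * s z) n) (Metric.thickening δ T) :=
    fun σ n => differentiableOn_cdS Metric.isOpen_thickening (hs.const_mul _)
      (fun z hz => norm_ne_zero_iff.1
        (by rw [norm_intUnit_mul]; exact norm_ne_zero_iff.2 (h0 z hz))) n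
  -- `4 / δ` is the inverse radius of Cauchy discs that stay in the half-width neighbourhood.
  refine ⟨4 / δ, L, by positivity, hL0, fun σ n => ?_, fun σ n k hk => ?_⟩
  · rw [← ENNReal.ofReal_mul (by linarith), ← ENNReal.ofReal_mul (by nlinarith)]
    refine linftyNorm_le_of_forall measurableSet_Icc fun x hx => ?_
    have hb : ∀ τ ∈ Set.uIoc ξ x, ‖dSpm ξ η a σ n τ‖ ≤ M * (L ^ n * (n : ℝ) ^ n) := by
      intro τ hτ
      rw [uIoc_of_le hx.1] at hτ
      have hτI : τ ∈ Icc ξ η := ⟨hτ.1.le, hτ.2.trans hx.2⟩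
      rw [heq σ n τ hτI]
      exact hc σ n τ (hIU _ (by linarith) τ hτI)
    refine (intervalIntegral.norm_integral_le_of_norm_le_const hb).trans ?_
    rw [abs_of_nonneg (by linarith [hx.1])]
    calc M * (L ^ n * (n : ℝ) ^ n) * (x - ξ) ≤ M * (L ^ n * (n : ℝ) ^ n) * (η - ξ) := by
          have := hx.2
          gcongr
      _ = _ := by ring
  · obtain ⟨k, rfl⟩ : ∃ l, k = l + 1 := ⟨k - 1, by omega⟩
    rw [← ENNReal.ofReal_mul hM.le, add_tsub_cancel_right]
    refine linftyNorm_le_of_forall measurableSet_Icc fun x hx => ?_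
    have := iteratedDerivWithin_succ_integral hξη Metric.isOpen_thickening (hIU δ hδ)
      (hdiff σ n) (heq σ n) k x hx
    unfold Spm
    rw [this]
    have hsub : Metric.closedBall (x : ℂ) (δ / 4) ⊆ Metric.thickening (δ - δ / 2) T := by
      intro w hw
      rw [Metric.mem_closedBall] at hw
      exact Metric.mem_thickening_iff.2 ⟨x, hIT x hx, by linarith⟩
    refine (Complex.norm_iteratedDeriv_le_of_forall_mem_sphere_norm_le k (R := δ / 4)
      (C := M * (L ^ n * (n : ℝ) ^ n)) (by positivity)
      ((hdiff σ n).diffContOnCl_ball (hsub.trans (Metric.thickening_mono (by linarith) T)))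
      fun w hw => hc σ n w (hsub (Metric.sphere_subset_closedBall hw))).trans (le_of_eq ?_)
    rw [div_pow, div_pow]
    field_simp
    rw [← mul_pow, mul_div_cancel₀ _ hδ.ne']

end Extension

/-! ### An energy estimate -/

/-- Grönwall for the energy `a |E| ^ 2 + ε ^ 2 |E'| ^ 2`. Weighting the two terms this way makes the
oscillatory contributions cancel in its derivative, so the growth rate does not depend on `ε`. -/
theorem energy_estimate {ξ η : ℝ} {ε A a₀ F : ℝ} {a a' : ℝ → ℝ} {E E₁ E₂ : ℝ → ℂ}
    (hε : 0 < ε) (ha₀ : 0 < a₀) (hA : 0 ≤ A) (hF : 0 ≤ F)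
    (ha : ∀ x ∈ Icc ξ η, a₀ ≤ a x)
    (ha' : ∀ x ∈ Icc ξ η, HasDerivWithinAt a (a' x) (Icc ξ η) x)
    (haA : ∀ x ∈ Icc ξ η, |a' x| ≤ A)
    (hE : ∀ x ∈ Icc ξ η, HasDerivWithinAt E (E₁ x) (Icc ξ η) x)
    (hE₁ : ∀ x ∈ Icc ξ η, HasDerivWithinAt E₁ (E₂ x) (Icc ξ η) x)
    (hode : ∀ x ∈ Icc ξ η, ‖(ε : ℂ) ^ 2 * E₂ x + (a x : ℂ) * E x‖ ≤ F)
    (hE0 : E ξ = 0) (hE10 : E₁ ξ = 0) :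
    ∀ x ∈ Icc ξ η, ‖E x‖ ≤
      √(Real.exp ((A / a₀ + 1) * (η - ξ)) / ((A / a₀ + 1) * a₀)) * (F / ε) := by
  set K := A / a₀ + 1 with hK
  have hK0 : 0 < K := by positivity
  -- Chosen so that `K * c` is the forcing term `F ^ 2 / ε ^ 2`; then `H' ≤ K * (H + c)` and `g` is
  -- nonincreasing.
  set c := F ^ 2 / ε ^ 2 / K with hc
  set H : ℝ → ℝ := fun x => a x * ‖E x‖ ^ 2 + ε ^ 2 * ‖E₁ x‖ ^ 2 with hH
  set g : ℝ → ℝ := fun x => Real.exp (-(K * (x - ξ))) * (H x + c) with hg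
  set H' : ℝ → ℝ := fun x => (a' x * ‖E x‖ ^ 2 + a x * (2 * inner ℝ (E x) (E₁ x)))
    + ε ^ 2 * (2 * inner ℝ (E₁ x) (E₂ x)) with hH'
  have hHd : ∀ x ∈ Icc ξ η, HasDerivWithinAt H (H' x) (Icc ξ η) x := fun x hx =>
    ((ha' x hx).mul (hE x hx).norm_sq).add ((hE₁ x hx).norm_sq.const_mul _)
  have hgd : ∀ x ∈ Icc ξ η, HasDerivWithinAt g
      (Real.exp (-(K * (x - ξ))) * (-(K * 1)) * (H x + c) + Real.exp (-(K * (x - ξ))) * H' x)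
      (Icc ξ η) x := fun x hx =>
    ((((hasDerivWithinAt_id x _).sub_const ξ).const_mul K).neg.exp).mul ((hHd x hx).add_const c)
  have hH'le : ∀ x ∈ Icc ξ η, H' x ≤ K * (H x + c) := by
    intro x hx
    -- The cross terms `a ⟨E, E₁⟩` and `ε ^ 2 ⟨E₁, E₂⟩` combine into a pairing of `E₁` with the
    -- residual of the equation.
    have hin : H' x = a' x * ‖E x‖ ^ 2
        + 2 * inner ℝ (E₁ x) ((ε : ℂ) ^ 2 * E₂ x + (a x : ℂ) * E x) := by
      have h1 : (ε : ℂ) ^ 2 * E₂ x = (ε ^ 2 : ℝ) • E₂ x := by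
        rw [Complex.real_smul]; push_cast; rfl
      have h2 : (a x : ℂ) * E x = a x • E x := by rw [Complex.real_smul]
      rw [hH', h1, h2, inner_add_right, inner_smul_right, inner_smul_right,
        real_inner_comm (E x) (E₁ x)]
      ring
    have hcs := (real_inner_le_norm (E₁ x) ((ε : ℂ) ^ 2 * E₂ x + (a x : ℂ) * E x)).trans
      (mul_le_mul_of_nonneg_left (hode x hx) (norm_nonneg _))
    have h3 : a' x * ‖E x‖ ^ 2 ≤ A / a₀ * (a x * ‖E x‖ ^ 2) := by
      calc a' x * ‖E x‖ ^ 2 ≤ A * ‖E x‖ ^ 2 := by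
            gcongr
            exact (le_abs_self _).trans (haA x hx)
        _ = A / a₀ * (a₀ * ‖E x‖ ^ 2) := by field_simp
        _ ≤ _ := by
            gcongr
            exact ha x hx
    have h4 : 2 * (‖E₁ x‖ * F) ≤ ε ^ 2 * ‖E₁ x‖ ^ 2 + F ^ 2 / ε ^ 2 := by
      have := two_mul_le_add_sq (ε * ‖E₁ x‖) (F / ε)
      rw [mul_pow, div_pow] at this
      refine le_trans (le_of_eq ?_) this
      field_simp
    have h5 : 0 ≤ a x * ‖E x‖ ^ 2 := mul_nonneg (ha₀.le.trans (ha x hx)) (by positivity)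
    have h6 : 0 ≤ A / a₀ * (ε ^ 2 * ‖E₁ x‖ ^ 2) := by positivity
    have h7 : K * c = F ^ 2 / ε ^ 2 := by rw [hc]; field_simp
    rw [hin, mul_add, h7, hH, hK]
    nlinarith
  have hanti : AntitoneOn g (Icc ξ η) := by
    have hint : ∀ x ∈ interior (Icc ξ η), HasDerivAt g _ x := fun x hx =>
      (hgd x (interior_subset hx)).hasDerivAt (mem_interior_iff_mem_nhds.1 hx)
    refine antitoneOn_of_deriv_nonpos (convex_Icc ξ η)
      (fun x hx => (hgd x hx).continuousWithinAt)
      (fun x hx => (hint x hx).differentiableAt.differentiableWithinAt) fun x hx => ?_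
    rw [(hint x hx).deriv]
    have := hH'le x (interior_subset hx)
    have h := mul_nonneg (Real.exp_pos (-(K * (x - ξ)))).le (sub_nonneg.2 this)
    linarith
  intro x hx
  have hξ : ξ ∈ Icc ξ η := left_mem_Icc.2 (hx.1.trans hx.2)
  have h1 := hanti hξ hx hx.1
  have hgξ : g ξ = c := by simp [hg, hH, hE0, hE10]
  rw [hgξ, hg] at h1
  have h2 : H x + c ≤ Real.exp (K * (η - ξ)) * c := by
    calc H x + c = Real.exp (K * (x - ξ)) * (Real.exp (-(K * (x - ξ))) * (H x + c)) := by
          rw [← mul_assoc, ← Real.exp_add, add_neg_cancel, Real.exp_zero, one_mul]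
      _ ≤ Real.exp (K * (x - ξ)) * c := by gcongr
      _ ≤ _ := by
          have := hx.2
          gcongr
  have hc0 : 0 ≤ c := by positivity
  have h3 : a₀ * ‖E x‖ ^ 2 ≤ Real.exp (K * (η - ξ)) * c := by
    have : a₀ * ‖E x‖ ^ 2 ≤ a x * ‖E x‖ ^ 2 := by
      gcongr
      exact ha x hx
    have h' : 0 ≤ ε ^ 2 * ‖E₁ x‖ ^ 2 := by positivity
    simp only [hH] at h2
    linarith
  refine le_of_sq_le_sq ?_ (by positivity)
  rw [mul_pow, Real.sq_sqrt (by positivity)]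
  calc ‖E x‖ ^ 2 = a₀ * ‖E x‖ ^ 2 / a₀ := by field_simp
    _ ≤ Real.exp (K * (η - ξ)) * c / a₀ := by gcongr
    _ = _ := by
      rw [hc]
      field_simp

/-! ### The residual of a truncated WKB series -/

/-- The square of indices is split into the pairs with `j + k ≤ N`, grouped by their sum, and those
with `j + k > N`. -/
theorem sum_mul_sum_eq_triangle (g : ℕ → ℂ) (N : ℕ) :
    (∑ n ∈ Finset.range (N + 1), g n) * (∑ n ∈ Finset.range (N + 1), g n)
      = ∑ m ∈ Finset.range (N + 1), ∑ k ∈ Finset.range (m + 1), g k * g (m - k)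
        + ∑ j ∈ Finset.range (N + 1), ∑ k ∈ Finset.Ico (N + 1 - j) (N + 1), g j * g k := by
  rw [Finset.sum_range_diag_flip (N + 1) fun j k => g j * g k, ← Finset.sum_add_distrib,
    Finset.sum_mul_sum]
  refine Finset.sum_congr rfl fun j _ => ?_
  rw [Finset.range_eq_Ico, Finset.range_eq_Ico,
    Finset.sum_Ico_consecutive _ (Nat.zero_le _) (Nat.sub_le _ _)]

theorem wkb_residual {f d : ℕ → ℂ} {a : ℂ} (ε : ℂ) (h0 : f 0 ≠ 0) (ha : f 0 ^ 2 = -a)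
    (hf : ∀ n, f (n + 1) = -(1 / (2 * f 0)) *
      ((∑ j ∈ Finset.Icc 1 n, f j * f (n + 1 - j)) + d n)) (N : ℕ) :
    (∑ n ∈ Finset.range (N + 1), ε ^ n * f n) ^ 2
        + ε * (∑ n ∈ Finset.range (N + 1), ε ^ n * d n) + a
      = ε ^ (N + 1) * d N + ∑ j ∈ Finset.range (N + 1), ∑ k ∈ Finset.Ico (N + 1 - j) (N + 1),
          (ε ^ j * f j) * (ε ^ k * f k) := by
  -- By the recursion, the order `n + 1` of the square cancels `ε * (ε ^ n * d n)`. Only the term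
  -- with `d N` has no partner of order at most `N`.
  have hdiag : ∀ n, ∑ k ∈ Finset.range (n + 1 + 1), (ε ^ k * f k) * (ε ^ (n + 1 - k) * f (n + 1 - k))
      = -(ε ^ (n + 1) * d n) := by
    intro n
    have h1 : ∀ k ∈ Finset.range (n + 1 + 1),
        (ε ^ k * f k) * (ε ^ (n + 1 - k) * f (n + 1 - k)) = ε ^ (n + 1) * (f k * f (n + 1 - k)) := by
      intro k hk
      rw [← pow_mul_pow_sub ε (Nat.lt_succ_iff.1 (Finset.mem_range.1 hk))]
      ring
    rw [Finset.sum_congr rfl h1, ← Finset.mul_sum, Finset.sum_range_succ, Finset.sum_range_succ',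
      Finset.range_eq_Ico, Finset.sum_Ico_add' (fun j => f j * f (n + 1 - j)) 0 n 1,
      show Finset.Ico (0 + 1) (n + 1) = Finset.Icc 1 n by ext; simp, Nat.sub_self, Nat.sub_zero]
    have := hf n
    have h2 : 2 * f 0 * f (n + 1) = -((∑ j ∈ Finset.Icc 1 n, f j * f (n + 1 - j)) + d n) := by
      rw [this]
      field_simp
    linear_combination ε ^ (n + 1) * h2
  rw [sq, sum_mul_sum_eq_triangle, Finset.sum_range_succ', Finset.sum_congr rfl fun n _ => hdiag n,
    Finset.sum_range_succ (fun n => ε ^ n * d n), Finset.sum_neg_distrib, mul_add, Finset.mul_sum]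
  have h3 : ∑ n ∈ Finset.range N, ε * (ε ^ n * d n) = ∑ n ∈ Finset.range N, ε ^ (n + 1) * d n :=
    Finset.sum_congr rfl fun n _ => by ring
  rw [h3]
  simp only [zero_add, Finset.sum_range_one, pow_zero, one_mul]
  linear_combination ha

/-! ### The error of the WKB approximation -/

section Error

variable {ξ η : ℝ} {a : ℝ → ℝ}

theorem Spm_left (σ : ℤˣ) (n : ℕ) : Spm ξ η a σ n ξ = 0 :=
  intervalIntegral.integral_same

theorem expo_left (ε : ℝ) (N : ℕ) (σ : ℤˣ) : expo ξ η a ε N σ ξ = 0 := by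
  simp [expo, Spm_left]

theorem denom_eq (ε : ℝ) (N : ℕ) :
    denom ξ η a ε N = slopeSum ξ η a ε N 1 - slopeSum ξ η a ε N (-1) := by
  simp only [denom, slopeSum, mul_sub, Finset.sum_sub_distrib]

theorem alpha_add_beta {ε : ℝ} {N : ℕ} (φ₀ φ₁ : ℂ) (hD : denom ξ η a ε N ≠ 0) :
    alpha ξ η a ε φ₀ φ₁ N + beta ξ η a ε φ₀ φ₁ N = φ₀ := by
  rw [alpha, beta, ← add_div, div_eq_iff hD, denom_eq]
  ring

theorem alpha_mul_add_beta_mul {ε : ℝ} {N : ℕ} (φ₀ φ₁ : ℂ) (hD : denom ξ η a ε N ≠ 0) :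
    alpha ξ η a ε φ₀ φ₁ N * slopeSum ξ η a ε N (-1)
      + beta ξ η a ε φ₀ φ₁ N * slopeSum ξ η a ε N 1 = φ₁ := by
  rw [alpha, beta, div_mul_eq_mul_div, div_mul_eq_mul_div, ← add_div, div_eq_iff hD, denom_eq]
  ring

theorem norm_alpha_le {ε R B d : ℝ} {N : ℕ} {φ₀ φ₁ : ℂ} (h₀ : ‖φ₀‖ ≤ R) (h₁ : ‖φ₁‖ ≤ R)
    (hB : ∀ σ, ‖slopeSum ξ η a ε N σ‖ ≤ B) (hd : 0 < d) (hD : d ≤ ‖denom ξ η a ε N‖) :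
    ‖alpha ξ η a ε φ₀ φ₁ N‖ ≤ R * (B + 1) / d := by
  have hR : 0 ≤ R := (norm_nonneg _).trans h₀
  have hB0 : 0 ≤ B := (norm_nonneg _).trans (hB 1)
  rw [alpha, norm_div]
  gcongr
  calc _ ≤ ‖φ₀‖ * ‖slopeSum ξ η a ε N 1‖ + ‖φ₁‖ := by
        rw [← norm_mul]
        exact norm_sub_le _ _
    _ ≤ R * B + R := by gcongr; exact hB 1
    _ = _ := by ring

theorem norm_beta_le {ε R B d : ℝ} {N : ℕ} {φ₀ φ₁ : ℂ} (h₀ : ‖φ₀‖ ≤ R) (h₁ : ‖φ₁‖ ≤ R)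
    (hB : ∀ σ, ‖slopeSum ξ η a ε N σ‖ ≤ B) (hd : 0 < d) (hD : d ≤ ‖denom ξ η a ε N‖) :
    ‖beta ξ η a ε φ₀ φ₁ N‖ ≤ R * (B + 1) / d := by
  have hR : 0 ≤ R := (norm_nonneg _).trans h₀
  have hB0 : 0 ≤ B := (norm_nonneg _).trans (hB 1)
  rw [beta, norm_div]
  gcongr
  calc _ ≤ ‖φ₁‖ + ‖φ₀‖ * ‖slopeSum ξ η a ε N (-1)‖ := by
        rw [← norm_mul]
        exact norm_sub_le _ _
    _ ≤ R + R * B := by gcongr; exact hB (-1)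
    _ = _ := by ring

theorem zpow_sub_one_mul_self {ε : ℂ} (hε : ε ≠ 0) (n : ℕ) : ε * ε ^ ((n : ℤ) - 1) = ε ^ n := by
  rw [zpow_sub_one₀ hε, zpow_natCast, mul_comm, inv_mul_cancel_right₀ hε]

/-- The difference has zero Cauchy data at `ξ`, and inserting it in the equation leaves only the
residuals of the two exponentials, weighted by `α` and `β`; `energy_estimate` applies. -/
theorem norm_sub_phiWKB_le {ε a₀ A R B₁ B₂ d ρ : ℝ} {a' : ℝ → ℝ} {N : ℕ} {φ₀ φ₁ : ℂ} {φ : ℝ → ℂ}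
    (hξη : ξ < η) (hε : 0 < ε) (ha₀ : 0 < a₀) (hA : 0 ≤ A)
    (ha : ∀ x ∈ Icc ξ η, a₀ ≤ a x)
    (ha' : ∀ x ∈ Icc ξ η, HasDerivWithinAt a (a' x) (Icc ξ η) x)
    (haA : ∀ x ∈ Icc ξ η, |a' x| ≤ A)
    (hS : ∀ σ n, ContDiffOn ℝ 1 (dSpm ξ η a σ n) (Icc ξ η))
    (hρ : ∀ σ, ∀ x ∈ Icc ξ η,
      ‖(∑ n ∈ Finset.range (N + 1), (ε : ℂ) ^ n * dSpm ξ η a σ n x) ^ 2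
        + ε * (∑ n ∈ Finset.range (N + 1),
            (ε : ℂ) ^ n * derivWithin (dSpm ξ η a σ n) (Icc ξ η) x) + a x‖ ≤ ρ)
    (hB₁ : ∀ σ, ∀ x ∈ Icc ξ η, ‖Complex.exp (expo ξ η a ε N σ x)‖ ≤ B₁)
    (hB₂ : ∀ σ, ‖slopeSum ξ η a ε N σ‖ ≤ B₂) (hd : 0 < d) (hD : d ≤ ‖denom ξ η a ε N‖)
    (h₀ : ‖φ₀‖ ≤ R) (h₁ : ‖φ₁‖ ≤ R) (hφ : IsSolution ξ η a ε φ₀ φ₁ φ) :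
    ∀ x ∈ Icc ξ η, ‖φ x - phiWKB ξ η a ε φ₀ φ₁ N x‖ ≤
      √(Real.exp ((A / a₀ + 1) * (η - ξ)) / ((A / a₀ + 1) * a₀)) *
        (2 * (R * (B₂ + 1) / d) * B₁ * ρ / ε) := by
  have hεc : (ε : ℂ) ≠ 0 := by exact_mod_cast hε.ne'
  have hξ : ξ ∈ Icc ξ η := left_mem_Icc.2 hξη.le
  have hR : 0 ≤ R := (norm_nonneg _).trans h₀
  have hB₂0 : 0 ≤ B₂ := (norm_nonneg _).trans (hB₂ 1)
  have hB₁0 : 0 ≤ B₁ := (norm_nonneg _).trans (hB₁ 1 ξ hξ)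
  have hρ0 : 0 ≤ ρ := (norm_nonneg _).trans (hρ 1 ξ hξ)
  have hD0 : denom ξ η a ε N ≠ 0 := norm_pos_iff.1 (hd.trans_le hD)
  have hu := uniqueDiffOn_Icc hξη
  set α := alpha ξ η a ε φ₀ φ₁ N with hα
  set β := beta ξ η a ε φ₀ φ₁ N with hβ
  set e : ℤˣ → ℝ → ℂ := fun σ => expo ξ η a ε N σ with he
  set e₁ : ℤˣ → ℝ → ℂ := fun σ x =>
    ∑ n ∈ Finset.range (N + 1), (ε : ℂ) ^ ((n : ℤ) - 1) * dSpm ξ η a σ n x with he₁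
  set e₂ : ℤˣ → ℝ → ℂ := fun σ x => ∑ n ∈ Finset.range (N + 1),
    (ε : ℂ) ^ ((n : ℤ) - 1) * derivWithin (dSpm ξ η a σ n) (Icc ξ η) x with he₂
  have hed : ∀ σ, ∀ x ∈ Icc ξ η, HasDerivWithinAt (e σ) (e₁ σ x) (Icc ξ η) x := fun σ x hx =>
    HasDerivWithinAt.fun_sum fun n _ =>
      (hasDerivWithinAt_integral_Icc (hS σ n).continuousOn x hx).const_mul _
  have hed₁ : ∀ σ, ∀ x ∈ Icc ξ η, HasDerivWithinAt (e₁ σ) (e₂ σ x) (Icc ξ η) x := fun σ x hx =>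
    HasDerivWithinAt.fun_sum fun n _ =>
      (((hS σ n).differentiableOn one_ne_zero x hx).hasDerivWithinAt).const_mul _
  have hεe₁ : ∀ σ x, (ε : ℂ) * e₁ σ x
      = ∑ n ∈ Finset.range (N + 1), (ε : ℂ) ^ n * dSpm ξ η a σ n x := by
    intro σ x
    rw [he₁, Finset.mul_sum]
    exact Finset.sum_congr rfl fun n _ => by rw [← mul_assoc, zpow_sub_one_mul_self hεc]
  have hεe₂ : ∀ σ x, (ε : ℂ) * e₂ σ x = ∑ n ∈ Finset.range (N + 1),
      (ε : ℂ) ^ n * derivWithin (dSpm ξ η a σ n) (Icc ξ η) x := by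
    intro σ x
    rw [he₂, Finset.mul_sum]
    exact Finset.sum_congr rfl fun n _ => by rw [← mul_assoc, zpow_sub_one_mul_self hεc]
  have hφ1 : ContDiffOn ℝ 1 (derivWithin φ (Icc ξ η)) (Icc ξ η) :=
    hφ.contDiffOn.derivWithin hu (by norm_num)
  have hEd : ∀ x ∈ Icc ξ η, HasDerivWithinAt (fun x => φ x - phiWKB ξ η a ε φ₀ φ₁ N x)
      (derivWithin φ (Icc ξ η) x - (α * (Complex.exp (e (-1) x) * e₁ (-1) x)
        + β * (Complex.exp (e 1 x) * e₁ 1 x))) (Icc ξ η) x := fun x hx =>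
    (hφ.contDiffOn.differentiableOn two_ne_zero x hx).hasDerivWithinAt.sub
      (((hed (-1) x hx).cexp.const_mul α).add ((hed 1 x hx).cexp.const_mul β))
  have hEd₁ : ∀ x ∈ Icc ξ η, HasDerivWithinAt
      (fun x => derivWithin φ (Icc ξ η) x - (α * (Complex.exp (e (-1) x) * e₁ (-1) x)
        + β * (Complex.exp (e 1 x) * e₁ 1 x)))
      (iteratedDerivWithin 2 φ (Icc ξ η) x
        - (α * (Complex.exp (e (-1) x) * e₁ (-1) x * e₁ (-1) x
            + Complex.exp (e (-1) x) * e₂ (-1) x)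
          + β * (Complex.exp (e 1 x) * e₁ 1 x * e₁ 1 x + Complex.exp (e 1 x) * e₂ 1 x)))
      (Icc ξ η) x := by
    intro x hx
    have h2 : HasDerivWithinAt (derivWithin φ (Icc ξ η)) (iteratedDerivWithin 2 φ (Icc ξ η) x)
        (Icc ξ η) x := by
      rw [iteratedDerivWithin_succ, iteratedDerivWithin_one]
      exact (hφ1.differentiableOn one_ne_zero x hx).hasDerivWithinAt
    exact h2.sub ((((hed (-1) x hx).cexp.mul (hed₁ (-1) x hx)).const_mul α).add
      (((hed 1 x hx).cexp.mul (hed₁ 1 x hx)).const_mul β))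
  refine energy_estimate hε ha₀ hA (by positivity) ha ha' haA hEd hEd₁ (fun x hx => ?_) ?_ ?_
  · have hr : ∀ σ, ‖((ε : ℂ) * e₁ σ x) ^ 2 + ε * (ε * e₂ σ x) + a x‖ ≤ ρ := fun σ => by
      rw [hεe₁, hεe₂]
      exact hρ σ x hx
    have hkey : (ε : ℂ) ^ 2 * (iteratedDerivWithin 2 φ (Icc ξ η) x
        - (α * (Complex.exp (e (-1) x) * e₁ (-1) x * e₁ (-1) x
            + Complex.exp (e (-1) x) * e₂ (-1) x)
          + β * (Complex.exp (e 1 x) * e₁ 1 x * e₁ 1 x + Complex.exp (e 1 x) * e₂ 1 x)))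
        + (a x : ℂ) * (φ x - phiWKB ξ η a ε φ₀ φ₁ N x)
        = -(α * Complex.exp (e (-1) x) *
              (((ε : ℂ) * e₁ (-1) x) ^ 2 + ε * (ε * e₂ (-1) x) + a x)
            + β * Complex.exp (e 1 x) *
              (((ε : ℂ) * e₁ 1 x) ^ 2 + ε * (ε * e₂ 1 x) + a x)) := by
      rw [phiWKB, ← hα, ← hβ]
      linear_combination hφ.ode x hx
    rw [hkey, norm_neg]
    have hα' := norm_alpha_le h₀ h₁ hB₂ hd hD
    have hβ' := norm_beta_le h₀ h₁ hB₂ hd hD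
    calc _ ≤ ‖α‖ * ‖Complex.exp (e (-1) x)‖ *
              ‖((ε : ℂ) * e₁ (-1) x) ^ 2 + ε * (ε * e₂ (-1) x) + a x‖
            + ‖β‖ * ‖Complex.exp (e 1 x)‖ *
              ‖((ε : ℂ) * e₁ 1 x) ^ 2 + ε * (ε * e₂ 1 x) + a x‖ := by
            simp only [← norm_mul]
            exact norm_add_le _ _
      _ ≤ (R * (B₂ + 1) / d) * B₁ * ρ + (R * (B₂ + 1) / d) * B₁ * ρ := by
            gcongr
            · exact hB₁ _ x hx
            · exact hr _
            · exact hB₁ _ x hx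
            · exact hr _
      _ = _ := by ring
  · simp only [phiWKB, expo_left, Complex.exp_zero, mul_one, alpha_add_beta φ₀ φ₁ hD0, hφ.init,
      sub_self]
  · have hs : ∀ σ, (ε : ℂ) * e₁ σ ξ = slopeSum ξ η a ε N σ := fun σ => hεe₁ σ ξ
    simp only [he, expo_left, Complex.exp_zero, one_mul]
    refine (mul_eq_zero.1 ?_).resolve_left hεc
    have := alpha_mul_add_beta_mul φ₀ φ₁ hD0
    rw [← hs, ← hs] at this
    linear_combination hφ.init_deriv - this

end Error

/-! ### Consequences of the series bounds -/

section Bounds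

variable {ξ η : ℝ} {a : ℝ → ℝ} {M K₁ K₂ : ℝ}

theorem SeriesBounds.norm_Spm_le (h : SeriesBounds ξ η a (ENNReal.ofReal M) K₁ K₂)
    (hξη : ξ < η) (hM : 0 ≤ M) (hS : ∀ σ n, ContDiffOn ℝ 1 (dSpm ξ η a σ n) (Icc ξ η))
    (σ : ℤˣ) (n : ℕ) :
    ∀ x ∈ Icc ξ η, ‖Spm ξ η a σ n x‖ ≤ (η - ξ) * M * (K₂ ^ n * (n : ℝ) ^ n) := by
  have h2 := h.pos₂
  have hl : 0 ≤ η - ξ := by linarith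
  refine norm_le_of_linftyNorm_le_Icc hξη (fun x hx =>
    (hasDerivWithinAt_integral_Icc (hS σ n).continuousOn x hx).continuousWithinAt)
    (by positivity) ?_
  rw [ENNReal.ofReal_mul (by positivity), ENNReal.ofReal_mul hl]
  exact h.bound σ n

theorem derivWithin_Spm (hξη : ξ < η) (hS : ∀ σ n, ContDiffOn ℝ 1 (dSpm ξ η a σ n) (Icc ξ η))
    (σ : ℤˣ) (n : ℕ) :
    ∀ x ∈ Icc ξ η, derivWithin (Spm ξ η a σ n) (Icc ξ η) x = dSpm ξ η a σ n x := fun x hx =>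
  (hasDerivWithinAt_integral_Icc (hS σ n).continuousOn x hx).derivWithin
    (uniqueDiffOn_Icc hξη x hx)

theorem SeriesBounds.norm_dSpm_le (h : SeriesBounds ξ η a (ENNReal.ofReal M) K₁ K₂)
    (hξη : ξ < η) (hM : 0 ≤ M) (hS : ∀ σ n, ContDiffOn ℝ 1 (dSpm ξ η a σ n) (Icc ξ η))
    (σ : ℤˣ) (n : ℕ) :
    ∀ x ∈ Icc ξ η, ‖dSpm ξ η a σ n x‖ ≤ M * (K₂ ^ n * (n : ℝ) ^ n) := by
  have h1 := h.pos₁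
  have h2 := h.pos₂
  have hd := derivWithin_Spm hξη hS σ n
  have hb := h.bound_deriv σ n 1 le_rfl
  rw [iteratedDerivWithin_one, ← ENNReal.ofReal_mul hM] at hb
  intro x hx
  rw [← hd x hx]
  refine (norm_le_of_linftyNorm_le_Icc hξη ((hS σ n).continuousOn.congr hd)
    (by positivity) hb x hx).trans (le_of_eq ?_)
  simp

theorem SeriesBounds.norm_derivWithin_dSpm_le
    (h : SeriesBounds ξ η a (ENNReal.ofReal M) K₁ K₂)
    (hξη : ξ < η) (hM : 0 ≤ M) (hS : ∀ σ n, ContDiffOn ℝ 1 (dSpm ξ η a σ n) (Icc ξ η))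
    (σ : ℤˣ) (n : ℕ) :
    ∀ x ∈ Icc ξ η, ‖derivWithin (dSpm ξ η a σ n) (Icc ξ η) x‖
      ≤ M * K₁ * (K₂ ^ n * (n : ℝ) ^ n) := by
  have h1 := h.pos₁
  have h2 := h.pos₂
  have hd : ∀ x ∈ Icc ξ η, iteratedDerivWithin 2 (Spm ξ η a σ n) (Icc ξ η) x
      = derivWithin (dSpm ξ η a σ n) (Icc ξ η) x := by
    intro x hx
    rw [iteratedDerivWithin_succ, iteratedDerivWithin_one]
    exact derivWithin_congr (derivWithin_Spm hξη hS σ n) (derivWithin_Spm hξη hS σ n x hx)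
  have hb := h.bound_deriv σ n 2 one_le_two
  rw [← ENNReal.ofReal_mul hM] at hb
  intro x hx
  rw [← hd x hx]
  refine (norm_le_of_linftyNorm_le_Icc hξη (((hS σ n).continuousOn_derivWithin
    (uniqueDiffOn_Icc hξη) le_rfl).congr hd) (by positivity) hb x hx).trans (le_of_eq ?_)
  simp
  ring

theorem Spm_zero_re (σ : ℤˣ) (x : ℝ) : (Spm ξ η a σ 0 x).re = 0 := by
  simp only [Spm, dSpm, dS_zero, s0]
  rw [intervalIntegral.integral_const_mul, intervalIntegral.integral_const_mul,
    intervalIntegral.integral_ofReal]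
  rcases Int.units_eq_one_or σ with rfl | rfl <;> simp

/-- The singular term `S_0 / ε` is imaginary and does not affect the modulus. -/
theorem norm_exp_expo_le {ε B : ℝ} {N : ℕ} {σ : ℤˣ} {x : ℝ}
    (hB : ‖∑ n ∈ Finset.range N, (ε : ℂ) ^ n * Spm ξ η a σ (n + 1) x‖ ≤ B) :
    ‖Complex.exp (expo ξ η a ε N σ x)‖ ≤ Real.exp B := by
  rw [Complex.norm_exp]
  gcongr
  have : expo ξ η a ε N σ x = ∑ n ∈ Finset.range N, (ε : ℂ) ^ n * Spm ξ η a σ (n + 1) x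
      + ((ε⁻¹ : ℝ) : ℂ) * Spm ξ η a σ 0 x := by
    rw [expo, Finset.sum_range_succ']
    congr 1
    · refine Finset.sum_congr rfl fun n _ => ?_
      rw [Nat.cast_add, Nat.cast_one, add_sub_cancel_right, zpow_natCast]
    · simp
  rw [this, Complex.add_re, Complex.re_ofReal_mul, Spm_zero_re, mul_zero, add_zero]
  exact (Complex.re_le_norm _).trans hB

/-- The sum bounded by `Z` is what remains of the admissible bounds after factoring out one `K₂`;
the same sum controls the slopes and the denominator. -/
theorem SeriesBounds.norm_exp_expo_le (h : SeriesBounds ξ η a (ENNReal.ofReal M) K₁ K₂)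
    (hξη : ξ < η) (hM : 0 ≤ M) (hS : ∀ σ n, ContDiffOn ℝ 1 (dSpm ξ η a σ n) (Icc ξ η))
    {ε Z : ℝ} (hε : 0 < ε) {N : ℕ}
    (hZ : ∑ n ∈ Finset.range N, ((n + 1 : ℕ) : ℝ) * (ε * K₂ * ((n + 1 : ℕ) : ℝ)) ^ n ≤ Z)
    (σ : ℤˣ) : ∀ x ∈ Icc ξ η,
      ‖Complex.exp (expo ξ η a ε N σ x)‖ ≤ Real.exp ((η - ξ) * M * K₂ * Z) := by
  intro x hx
  have h2 := h.pos₂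
  have hl : 0 ≤ η - ξ := by linarith
  refine WKB.norm_exp_expo_le ?_
  calc _ ≤ ∑ n ∈ Finset.range N, (η - ξ) * M * K₂ *
        (((n + 1 : ℕ) : ℝ) * (ε * K₂ * ((n + 1 : ℕ) : ℝ)) ^ n) := by
        refine norm_sum_le_of_le _ fun n _ => ?_
        rw [norm_mul, norm_pow, Complex.norm_real, Real.norm_of_nonneg hε.le]
        calc _ ≤ ε ^ n * ((η - ξ) * M * (K₂ ^ (n + 1) * ((n + 1 : ℕ) : ℝ) ^ (n + 1))) := by
              gcongr
              exact h.norm_Spm_le hξη hM hS σ (n + 1) x hx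
          _ = _ := by
              rw [mul_pow, mul_pow]
              ring
    _ ≤ _ := by
        rw [← Finset.mul_sum]
        gcongr

theorem SeriesBounds.norm_slopeSum_sub_le (h : SeriesBounds ξ η a (ENNReal.ofReal M) K₁ K₂)
    (hξη : ξ < η) (hM : 0 ≤ M) (hS : ∀ σ n, ContDiffOn ℝ 1 (dSpm ξ η a σ n) (Icc ξ η))
    {ε Z : ℝ} (hε : 0 < ε) {N : ℕ}
    (hZ : ∑ n ∈ Finset.range N, ((n + 1 : ℕ) : ℝ) * (ε * K₂ * ((n + 1 : ℕ) : ℝ)) ^ n ≤ Z)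
    (σ : ℤˣ) : ‖slopeSum ξ η a ε N σ - s0 a σ ξ‖ ≤ ε * (M * K₂ * Z) := by
  have h2 := h.pos₂
  have : slopeSum ξ η a ε N σ - s0 a σ ξ
      = ∑ n ∈ Finset.range N, (ε : ℂ) ^ (n + 1) * dSpm ξ η a σ (n + 1) ξ := by
    rw [slopeSum, Finset.sum_range_succ']
    simp [dSpm, dS_zero]
  rw [this]
  calc _ ≤ ∑ n ∈ Finset.range N, ε * (M * K₂) *
        (((n + 1 : ℕ) : ℝ) * (ε * K₂ * ((n + 1 : ℕ) : ℝ)) ^ n) := by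
        refine norm_sum_le_of_le _ fun n _ => ?_
        rw [norm_mul, norm_pow, Complex.norm_real, Real.norm_of_nonneg hε.le]
        calc _ ≤ ε ^ (n + 1) * (M * (K₂ ^ (n + 1) * ((n + 1 : ℕ) : ℝ) ^ (n + 1))) := by
              gcongr
              exact h.norm_dSpm_le hξη hM hS σ (n + 1) ξ (left_mem_Icc.2 hξη.le)
          _ = _ := by
              rw [mul_pow, mul_pow]
              ring
    _ ≤ _ := by
        rw [← Finset.mul_sum, mul_assoc]
        gcongr

theorem norm_s0 (σ : ℤˣ) (x : ℝ) : ‖s0 a σ x‖ = √(a x) := by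
  rw [s0, norm_intUnit_mul, norm_mul, Complex.norm_I, one_mul, Complex.norm_real,
    Real.norm_of_nonneg (Real.sqrt_nonneg _)]

theorem s0_neg_one (x : ℝ) : s0 a (-1) x = -s0 a 1 x := by
  simp [s0]

/-- `S_1' = -S_0'' / (2 S_0')` does not change when `S_0'` changes sign. Hence `D_{1,ε}` never
vanishes, which makes order 1 a safe choice for every `ε`. -/
theorem dSpm_neg_one_one (x : ℝ) : dSpm ξ η a (-1) 1 x = dSpm ξ η a 1 1 x := by
  have : s0 a (-1) = fun x => -s0 a 1 x := funext s0_neg_one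
  simp only [dSpm, dS_succ, dS_zero, this, derivWithin.fun_neg]
  simp

theorem denom_one (ε : ℝ) : denom ξ η a ε 1 = 2 * s0 a 1 ξ := by
  simp only [denom, Finset.sum_range_succ, Finset.range_zero, Finset.sum_empty, dSpm_neg_one_one,
    sub_self, mul_zero, add_zero, zero_add, pow_zero, one_mul]
  simp only [dSpm, dS_zero, s0_neg_one]
  ring

theorem SeriesBounds.le_norm_denom (h : SeriesBounds ξ η a (ENNReal.ofReal M) K₁ K₂)
    (hξη : ξ < η) (hM : 0 ≤ M) (hS : ∀ σ n, ContDiffOn ℝ 1 (dSpm ξ η a σ n) (Icc ξ η))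
    {ε Z : ℝ} (hε : 0 < ε) {N : ℕ}
    (hZ : ∑ n ∈ Finset.range N, ((n + 1 : ℕ) : ℝ) * (ε * K₂ * ((n + 1 : ℕ) : ℝ)) ^ n ≤ Z) :
    2 * √(a ξ) - 2 * (ε * (M * K₂ * Z)) ≤ ‖denom ξ η a ε N‖ := by
  have h1 := h.norm_slopeSum_sub_le hξη hM hS hε hZ 1
  have h2 := h.norm_slopeSum_sub_le hξη hM hS hε hZ (-1)
  have h3 : 2 * s0 a 1 ξ = denom ξ η a ε N - ((slopeSum ξ η a ε N 1 - s0 a 1 ξ)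
      - (slopeSum ξ η a ε N (-1) - s0 a (-1) ξ)) := by
    rw [denom_eq, s0_neg_one]
    ring
  have h4 := congrArg norm h3
  rw [norm_mul, norm_s0, Complex.norm_ofNat] at h4
  have h5 := norm_sub_le (denom ξ η a ε N) ((slopeSum ξ η a ε N 1 - s0 a 1 ξ)
      - (slopeSum ξ η a ε N (-1) - s0 a (-1) ξ))
  have h6 := norm_sub_le (slopeSum ξ η a ε N 1 - s0 a 1 ξ)
      (slopeSum ξ η a ε N (-1) - s0 a (-1) ξ)
  linarith

theorem dSpm_residual {x : ℝ} (hx : 0 < a x) (ε : ℝ) (N : ℕ) (σ : ℤˣ) :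
    (∑ n ∈ Finset.range (N + 1), (ε : ℂ) ^ n * dSpm ξ η a σ n x) ^ 2
        + ε * (∑ n ∈ Finset.range (N + 1),
            (ε : ℂ) ^ n * derivWithin (dSpm ξ η a σ n) (Icc ξ η) x) + a x
      = (ε : ℂ) ^ (N + 1) * derivWithin (dSpm ξ η a σ N) (Icc ξ η) x
        + ∑ j ∈ Finset.range (N + 1), ∑ k ∈ Finset.Ico (N + 1 - j) (N + 1),
          ((ε : ℂ) ^ j * dSpm ξ η a σ j x) * ((ε : ℂ) ^ k * dSpm ξ η a σ k x) := by
  have h0 : dSpm ξ η a σ 0 x = s0 a σ x := by rw [dSpm, dS_zero]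
  refine wkb_residual (f := fun n => dSpm ξ η a σ n x)
    (d := fun n => derivWithin (dSpm ξ η a σ n) (Icc ξ η) x) (ε : ℂ) ?_ ?_ (fun n => ?_) N
  · rw [h0, ← norm_pos_iff, norm_s0]
    exact Real.sqrt_pos.2 hx
  · have h1 : ((√(a x) : ℝ) : ℂ) ^ 2 = a x := by exact_mod_cast Real.sq_sqrt hx.le
    have h2 : (((σ : ℤ) : ℂ)) ^ 2 = 1 := by
      rcases Int.units_eq_one_or σ with rfl | rfl <;> simp
    rw [h0, s0, mul_pow, mul_pow, h1, h2, Complex.I_sq]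
    ring
  · rw [h0]
    exact dS_succ ξ η (s0 a σ) n x

/-- For `n ≤ N` the factor `n ^ n` is at most `N ^ n`, so the terms decay like `q ^ n`; at most `(N
+ 1) ^ 2` products remain, each of total order above `N`. -/
theorem SeriesBounds.norm_residual_le (h : SeriesBounds ξ η a (ENNReal.ofReal M) K₁ K₂)
    (hξη : ξ < η) (hM : 0 ≤ M) (hS : ∀ σ n, ContDiffOn ℝ 1 (dSpm ξ η a σ n) (Icc ξ η))
    (ha : ∀ x ∈ Icc ξ η, 0 < a x) {ε q : ℝ} (hε : 0 < ε) (hε1 : ε ≤ 1) (hq1 : q ≤ 1) {N : ℕ}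
    (hq : ε * K₂ * N ≤ q) (σ : ℤˣ) : ∀ x ∈ Icc ξ η,
      ‖(∑ n ∈ Finset.range (N + 1), (ε : ℂ) ^ n * dSpm ξ η a σ n x) ^ 2
        + ε * (∑ n ∈ Finset.range (N + 1),
            (ε : ℂ) ^ n * derivWithin (dSpm ξ η a σ n) (Icc ξ η) x) + a x‖
        ≤ (M * K₁ + M ^ 2) * (N + 1 : ℝ) ^ 2 * q ^ N := by
  intro x hx
  have h1 := h.pos₁
  have h2 := h.pos₂
  have hq0 : 0 ≤ q := le_trans (by positivity) hq
  have hpow : ∀ n ≤ N, ε ^ n * (K₂ ^ n * (n : ℝ) ^ n) ≤ q ^ n := by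
    intro n hn
    have hn' : (n : ℝ) ≤ N := by exact_mod_cast hn
    rw [← mul_pow, ← mul_pow, ← mul_assoc]
    refine pow_le_pow_left₀ (by positivity) (le_trans ?_ hq) n
    gcongr
  have hf : ∀ n ≤ N, ‖(ε : ℂ) ^ n * dSpm ξ η a σ n x‖ ≤ M * q ^ n := by
    intro n hn
    rw [norm_mul, norm_pow, Complex.norm_real, Real.norm_of_nonneg hε.le]
    calc _ ≤ ε ^ n * (M * (K₂ ^ n * (n : ℝ) ^ n)) := by
          gcongr
          exact h.norm_dSpm_le hξη hM hS σ n x hx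
      _ = M * (ε ^ n * (K₂ ^ n * (n : ℝ) ^ n)) := by ring
      _ ≤ _ := by
          gcongr
          exact hpow n hn
  have hd : ‖(ε : ℂ) ^ (N + 1) * derivWithin (dSpm ξ η a σ N) (Icc ξ η) x‖ ≤ M * K₁ * q ^ N := by
    rw [norm_mul, norm_pow, Complex.norm_real, Real.norm_of_nonneg hε.le]
    calc _ ≤ ε ^ (N + 1) * (M * K₁ * (K₂ ^ N * (N : ℝ) ^ N)) := by
          gcongr
          exact h.norm_derivWithin_dSpm_le hξη hM hS σ N x hx
      _ = M * K₁ * (ε ^ N * (K₂ ^ N * (N : ℝ) ^ N)) * ε := by ring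
      _ ≤ M * K₁ * q ^ N * 1 := by
          gcongr
          exact hpow N le_rfl
      _ = _ := mul_one _
  have hsum : ‖∑ j ∈ Finset.range (N + 1), ∑ k ∈ Finset.Ico (N + 1 - j) (N + 1),
      ((ε : ℂ) ^ j * dSpm ξ η a σ j x) * ((ε : ℂ) ^ k * dSpm ξ η a σ k x)‖
        ≤ M ^ 2 * (N + 1 : ℝ) ^ 2 * q ^ N := by
    have hj : ∀ j ∈ Finset.range (N + 1), ‖∑ k ∈ Finset.Ico (N + 1 - j) (N + 1),
        ((ε : ℂ) ^ j * dSpm ξ η a σ j x) * ((ε : ℂ) ^ k * dSpm ξ η a σ k x)‖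
        ≤ (N + 1 : ℝ) * (M ^ 2 * q ^ N) := by
      intro j hj
      have hjN := Nat.lt_succ_iff.1 (Finset.mem_range.1 hj)
      have hk : ∀ k ∈ Finset.Ico (N + 1 - j) (N + 1),
          ‖((ε : ℂ) ^ j * dSpm ξ η a σ j x) * ((ε : ℂ) ^ k * dSpm ξ η a σ k x)‖
            ≤ M ^ 2 * q ^ N := by
        intro k hk
        rw [Finset.mem_Ico] at hk
        rw [norm_mul]
        calc _ ≤ (M * q ^ j) * (M * q ^ k) := by
              gcongr
              · exact hf j hjN
              · exact hf k (by omega)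
          _ = M ^ 2 * q ^ (j + k) := by ring
          _ ≤ _ := by
              gcongr M ^ 2 * ?_
              exact pow_le_pow_of_le_one hq0 hq1 (by omega)
      refine (norm_sum_le_of_le _ hk).trans ?_
      rw [Finset.sum_const, Nat.card_Ico, nsmul_eq_mul]
      gcongr
      have : N + 1 - (N + 1 - j) ≤ N + 1 := by omega
      exact_mod_cast this
    refine (norm_sum_le_of_le _ hj).trans (le_of_eq ?_)
    rw [Finset.sum_const, Finset.card_range, nsmul_eq_mul]
    push_cast
    ring
  rw [dSpm_residual (ha x hx)]
  refine (norm_add_le_of_le hd hsum).trans ?_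
  have : M * K₁ * q ^ N * 1 ≤ M * K₁ * q ^ N * (N + 1 : ℝ) ^ 2 := by
    gcongr
    exact one_le_pow₀ (by linarith [(Nat.cast_nonneg N : (0 : ℝ) ≤ N)])
  linarith

theorem SeriesBounds.norm_residual_one_le (h : SeriesBounds ξ η a (ENNReal.ofReal M) K₁ K₂)
    (hξη : ξ < η) (hM : 0 ≤ M) (hS : ∀ σ n, ContDiffOn ℝ 1 (dSpm ξ η a σ n) (Icc ξ η))
    (ha : ∀ x ∈ Icc ξ η, 0 < a x) {ε : ℝ} (hε : 0 < ε) (hε1 : ε ≤ 1) (σ : ℤˣ) :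
    ∀ x ∈ Icc ξ η,
      ‖(∑ n ∈ Finset.range (1 + 1), (ε : ℂ) ^ n * dSpm ξ η a σ n x) ^ 2
        + ε * (∑ n ∈ Finset.range (1 + 1),
            (ε : ℂ) ^ n * derivWithin (dSpm ξ η a σ n) (Icc ξ η) x) + a x‖
        ≤ M * K₁ * K₂ + (M * K₂) ^ 2 := by
  intro x hx
  have h1 := h.pos₁
  have h2 := h.pos₂
  have hf := h.norm_dSpm_le hξη hM hS σ 1 x hx
  have hd := h.norm_derivWithin_dSpm_le hξη hM hS σ 1 x hx
  simp only [Nat.cast_one, pow_one, mul_one] at hf hd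
  have hsum : ∑ j ∈ Finset.range (1 + 1), ∑ k ∈ Finset.Ico (1 + 1 - j) (1 + 1),
      ((ε : ℂ) ^ j * dSpm ξ η a σ j x) * ((ε : ℂ) ^ k * dSpm ξ η a σ k x)
        = ((ε : ℂ) * dSpm ξ η a σ 1 x) ^ 2 := by
    simp [Finset.sum_range_succ, sq]
  rw [dSpm_residual (ha x hx), hsum]
  refine norm_add_le_of_le ?_ ?_
  · rw [norm_mul, norm_pow, Complex.norm_real, Real.norm_of_nonneg hε.le]
    exact (mul_le_of_le_one_left (norm_nonneg _) (pow_le_one₀ hε.le hε1)).trans hd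
  · rw [norm_pow, norm_mul, Complex.norm_real, Real.norm_of_nonneg hε.le]
    exact pow_le_pow_left₀ (by positivity)
      ((mul_le_of_le_one_left (norm_nonneg _) hε1).trans hf) 2

end Bounds

/-! ### Optimal truncation -/

theorem log_exp_one_div_two : Real.log (Real.exp 1 / 2) = 1 - Real.log 2 := by
  rw [Real.log_div (Real.exp_ne_zero 1) two_ne_zero, Real.log_exp]

theorem log_exp_one_div_two_pos : 0 < Real.log (Real.exp 1 / 2) := by
  rw [log_exp_one_div_two]
  linarith [Real.log_two_lt_d9]

/-- One of the two factors `y` is absorbed by `2 ^ y`, which lowers the rate from 1 to `1 - log 2 =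
log (e / 2)`; the other is kept as a power of `1 / ε`. -/
theorem floor_sq_mul_exp_le {y : ℝ} (hy : 1 ≤ y) :
    ((⌊y⌋₊ : ℝ) + 1) ^ 2 * Real.exp (-1) ^ ⌊y⌋₊
      ≤ 4 * Real.exp 1 / Real.log 2 * y * Real.exp (-(Real.log (Real.exp 1 / 2) * y)) := by
  have hl : 0 < Real.log 2 := Real.log_pos one_lt_two
  have h1 : (⌊y⌋₊ : ℝ) ≤ y := Nat.floor_le (by linarith)
  have h2 : y ≤ ⌊y⌋₊ + 1 := (Nat.lt_floor_add_one y).le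
  have h3 : Real.exp (-1) ^ ⌊y⌋₊ ≤ Real.exp (1 - y) := by
    rw [← Real.exp_nat_mul]
    gcongr
    linarith
  have h4 : y ≤ Real.exp (Real.log 2 * y) / Real.log 2 := by
    rw [le_div_iff₀ hl]
    linarith [Real.add_one_le_exp (Real.log 2 * y)]
  calc _ ≤ (y + y) ^ 2 * Real.exp (1 - y) := by gcongr
    _ = 4 * y * Real.exp (1 - y) * y := by ring
    _ ≤ 4 * y * Real.exp (1 - y) * (Real.exp (Real.log 2 * y) / Real.log 2) := by gcongr
    _ = 4 / Real.log 2 * y * (Real.exp (1 - y) * Real.exp (Real.log 2 * y)) := by ring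
    _ = 4 / Real.log 2 * y * (Real.exp 1 * Real.exp (-(Real.log (Real.exp 1 / 2) * y))) := by
      rw [← Real.exp_add, ← Real.exp_add, log_exp_one_div_two]
      ring_nf
    _ = _ := by ring

/-- Only the lower bound on `a` is assumed; its smoothness, needed in the energy estimate, is
recovered from `a = (Im S_0') ^ 2`. -/
theorem contDiffOn_coefficient {ξ η : ℝ} {a : ℝ → ℝ} (ha : ∀ x ∈ Icc ξ η, 0 < a x)
    (hS : ContDiffOn ℝ 1 (dSpm ξ η a 1 0) (Icc ξ η)) : ContDiffOn ℝ 1 a (Icc ξ η) := by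
  have h1 : ContDiffOn ℝ 1 (fun x => (dSpm ξ η a 1 0 x).im ^ 2) (Icc ξ η) :=
    (Complex.imCLM.contDiff.comp_contDiffOn hS).pow 2
  refine h1.congr fun x hx => ?_
  simp [dSpm, dS_zero, s0, Real.sq_sqrt (ha x hx).le]

theorem exists_error_const {ξ η : ℝ} {a : ℝ → ℝ} {a₀ M K₁ K₂ Z : ℝ} (hξη : ξ < η)
    (ha₀ : 0 < a₀) (ha : ∀ x ∈ Icc ξ η, a₀ ≤ a x) (hM : 0 ≤ M) (hZ : 0 ≤ Z)
    (hS : ∀ σ n, ContDiffOn ℝ 1 (dSpm ξ η a σ n) (Icc ξ η))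
    (h : SeriesBounds ξ η a (ENNReal.ofReal M) K₁ K₂) (R : ℝ) :
    ∃ W : ℝ, 0 ≤ W ∧ ∀ (ε ρ : ℝ) (N : ℕ), 0 < ε → ε ≤ 1 →
      ∑ n ∈ Finset.range N, ((n + 1 : ℕ) : ℝ) * (ε * K₂ * ((n + 1 : ℕ) : ℝ)) ^ n ≤ Z →
      √a₀ ≤ ‖denom ξ η a ε N‖ →
      (∀ σ, ∀ x ∈ Icc ξ η,
        ‖(∑ n ∈ Finset.range (N + 1), (ε : ℂ) ^ n * dSpm ξ η a σ n x) ^ 2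
          + ε * (∑ n ∈ Finset.range (N + 1),
              (ε : ℂ) ^ n * derivWithin (dSpm ξ η a σ n) (Icc ξ η) x) + a x‖ ≤ ρ) →
      ∀ (φ₀ φ₁ : ℂ) (φ : ℝ → ℂ), ‖φ₀‖ ≤ R → ‖φ₁‖ ≤ R → IsSolution ξ η a ε φ₀ φ₁ φ →
        error ξ η a ε φ₀ φ₁ φ N ≤ ENNReal.ofReal (W * ρ / ε) := by
  have h2 := h.pos₂
  have haC := contDiffOn_coefficient (fun x hx => ha₀.trans_le (ha x hx)) (hS 1 0)
  obtain ⟨A, hA⟩ := isCompact_Icc.exists_bound_of_continuousOn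
    (haC.continuousOn_derivWithin (uniqueDiffOn_Icc hξη) le_rfl)
  have hξ : ξ ∈ Icc ξ η := left_mem_Icc.2 hξη.le
  have hA0 : 0 ≤ A := (norm_nonneg _).trans (hA ξ hξ)
  set E := √(Real.exp ((A / a₀ + 1) * (η - ξ)) / ((A / a₀ + 1) * a₀)) with hE
  refine ⟨E * (2 * (|R| * (M + M * K₂ * Z + 1) / √a₀) * Real.exp ((η - ξ) * M * K₂ * Z)),
    by positivity, fun ε ρ N hε hε1 hsum hD hρ φ₀ φ₁ φ h₀ h₁ hφ => ?_⟩
  have hslope : ∀ σ, ‖slopeSum ξ η a ε N σ‖ ≤ M + M * K₂ * Z := by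
    intro σ
    have e1 := h.norm_slopeSum_sub_le hξη hM hS hε hsum σ
    have e2 := h.norm_dSpm_le hξη hM hS σ 0 ξ hξ
    rw [dSpm, dS_zero] at e2
    simp only [pow_zero, mul_one] at e2
    have e3 := norm_le_norm_add_norm_sub' (slopeSum ξ η a ε N σ) (s0 a σ ξ)
    have e4 : ε * (M * K₂ * Z) ≤ M * K₂ * Z := mul_le_of_le_one_left (by positivity) hε1
    linarith
  refine linftyNorm_le_of_forall measurableSet_Icc fun x hx => ?_
  refine (norm_sub_phiWKB_le hξη hε ha₀ hA0 ha
    (fun x hx => (haC.differentiableOn one_ne_zero x hx).hasDerivWithinAt) hA hS hρ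
    (fun σ => h.norm_exp_expo_le hξη hM hS hε hsum σ) hslope (Real.sqrt_pos.2 ha₀) hD
    (h₀.trans (le_abs_self R)) (h₁.trans (le_abs_self R)) hφ x hx).trans (le_of_eq ?_)
  ring

theorem exists_truncation {ξ η : ℝ} {a : ℝ → ℝ} {a₀ M K₁ K₂ : ℝ} (hξη : ξ < η)
    (ha₀ : 0 < a₀) (ha : ∀ x ∈ Icc ξ η, a₀ ≤ a x) (hM : 0 ≤ M)
    (hS : ∀ σ n, ContDiffOn ℝ 1 (dSpm ξ η a σ n) (Icc ξ η))
    (h : SeriesBounds ξ η a (ENNReal.ofReal M) K₁ K₂) :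
    ∃ N : ℝ → ℕ, (∀ ε ∈ Ioo (0 : ℝ) 1, 1 ≤ N ε ∧ denom ξ η a ε (N ε) ≠ 0) ∧
      (∃ κ > (0 : ℝ), ∃ ε₀ ∈ Ioo (0 : ℝ) 1, ∀ ε ∈ Ioc (0 : ℝ) ε₀, N ε = ⌊κ / ε⌋₊) ∧
      ∀ R : ℝ, ∃ C > (0 : ℝ), ∀ ε ∈ Ioo (0 : ℝ) 1, ∀ (φ₀ φ₁ : ℂ) (φ : ℝ → ℂ),
        ‖φ₀‖ ≤ R → ‖φ₁‖ ≤ R → IsSolution ξ η a ε φ₀ φ₁ φ →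
          error ξ η a ε φ₀ φ₁ φ (N ε) ≤ ENNReal.ofReal (C / ε ^ 2 *
            Real.exp (-(Real.log (Real.exp 1 / 2) / (Real.exp 1 * K₂ * ε)))) := by
  have h1 := h.pos₁
  have h2 := h.pos₂
  have ha0 : ∀ x ∈ Icc ξ η, 0 < a x := fun x hx => ha₀.trans_le (ha x hx)
  have hξ : ξ ∈ Icc ξ η := left_mem_Icc.2 hξη.le
  have hsq : √a₀ ≤ √(a ξ) := Real.sqrt_le_sqrt (ha ξ hξ)
  have hsq0 : 0 < √a₀ := Real.sqrt_pos.2 ha₀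
  have hM0 : 0 < M := by
    have := h.norm_dSpm_le hξη hM hS 1 0 ξ hξ
    rw [dSpm, dS_zero, norm_s0] at this
    simp only [pow_zero, mul_one] at this
    linarith
  set q := Real.exp (-1) with hq
  have hq0 : 0 < q := Real.exp_pos _
  have hq1 : q < 1 := Real.exp_zero ▸ Real.exp_lt_exp.2 (by norm_num)
  have hsumm : Summable fun n : ℕ => ((n + 1 : ℕ) : ℝ) * q ^ n := by
    have e1 := summable_pow_mul_geometric_of_norm_lt_one (R := ℝ) 1 (r := q)
      (by rwa [Real.norm_of_nonneg hq0.le])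
    refine (e1.add (summable_geometric_of_lt_one hq0.le hq1)).congr fun n => ?_
    push_cast
    ring
  set Z := ∑' n : ℕ, ((n + 1 : ℕ) : ℝ) * q ^ n with hZ
  have hZ1 : 1 ≤ Z := by
    have := hsumm.le_tsum 0 fun n _ => by positivity
    rw [← hZ] at this
    simpa using this
  -- With `N ≤ κ / ε` one has `ε K₂ N ≤ 1 / e = q`; the value `1 / e` minimizes `t ^ (t / (ε K₂))`
  -- over `t = ε K₂ N`.
  set κ := 1 / (Real.exp 1 * K₂) with hκ
  have hκ0 : 0 < κ := by positivity
  have hκq : K₂ * κ = q := by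
    rw [hκ, hq, Real.exp_neg]
    field_simp
  -- The three bounds ensure `ε₀ < 1`, `κ / ε ≥ 1` (so that `N ≥ 1`), and a denominator of modulus
  -- at least `√a₀`.
  set ε₀ := min (1 / 2) (min κ (√a₀ / (2 * (M * K₂ * Z)))) with hε₀
  have hε₀0 : 0 < ε₀ := by positivity
  have hε₀1 : ε₀ < 1 := (min_le_left _ _).trans_lt (by norm_num)
  have hZN : ∀ ε > 0, ∀ N : ℕ, ε * K₂ * N ≤ q →
      ∑ n ∈ Finset.range N, ((n + 1 : ℕ) : ℝ) * (ε * K₂ * ((n + 1 : ℕ) : ℝ)) ^ n ≤ Z := by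
    intro ε hε N hN
    refine le_trans (Finset.sum_le_sum fun n hn => ?_)
      (hsumm.sum_le_tsum (Finset.range N) fun n _ => by positivity)
    gcongr
    refine le_trans ?_ hN
    gcongr
    exact Finset.mem_range.1 hn
  have hZ1N : ∀ ε : ℝ, ∑ n ∈ Finset.range 1,
      ((n + 1 : ℕ) : ℝ) * (ε * K₂ * ((n + 1 : ℕ) : ℝ)) ^ n ≤ Z := by
    intro ε
    simpa using hZ1
  have hfloor : ∀ ε ∈ Ioc 0 ε₀, 1 ≤ κ / ε ∧ ε * K₂ * ⌊κ / ε⌋₊ ≤ q := by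
    intro ε hε
    have hεκ : ε ≤ κ := hε.2.trans ((min_le_right _ _).trans (min_le_left _ _))
    refine ⟨(one_le_div hε.1).2 hεκ, ?_⟩
    have e1 := hε.1
    calc ε * K₂ * ⌊κ / ε⌋₊ ≤ ε * K₂ * (κ / ε) := by
          gcongr
          exact Nat.floor_le (by positivity)
      _ = K₂ * κ := by field_simp
      _ = q := hκq
  have hDsmall : ∀ ε ∈ Ioc 0 ε₀, √a₀ ≤ ‖denom ξ η a ε ⌊κ / ε⌋₊‖ := by
    intro ε hε
    refine le_trans ?_ (h.le_norm_denom hξη hM hS hε.1 (hZN ε hε.1 _ (hfloor ε hε).2))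
    have e1 : ε ≤ √a₀ / (2 * (M * K₂ * Z)) :=
      hε.2.trans ((min_le_right _ _).trans (min_le_right _ _))
    rw [le_div_iff₀ (by positivity)] at e1
    linarith
  have hDone : ∀ ε, √a₀ ≤ ‖denom ξ η a ε 1‖ := by
    intro ε
    rw [denom_one, norm_mul, norm_s0, Complex.norm_ofNat]
    linarith
  refine ⟨fun ε => if ε ≤ ε₀ then ⌊κ / ε⌋₊ else 1, fun ε hε => ?_,
    ⟨κ, hκ0, ε₀, ⟨hε₀0, hε₀1⟩, fun ε hε => if_pos hε.2⟩, fun R => ?_⟩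
  · by_cases hc : ε ≤ ε₀
    · simp only [if_pos hc]
      exact ⟨Nat.le_floor (by exact_mod_cast (hfloor ε ⟨hε.1, hc⟩).1),
        norm_pos_iff.1 (hsq0.trans_le (hDsmall ε ⟨hε.1, hc⟩))⟩
    · simp only [if_neg hc]
      exact ⟨le_rfl, norm_pos_iff.1 (hsq0.trans_le (hDone ε))⟩
  · obtain ⟨W, hW, herr⟩ := exists_error_const (Z := Z) hξη ha₀ ha hM (by linarith) hS h R
    set b := Real.log (Real.exp 1 / 2) with hb
    have hb0 : 0 < b := log_exp_one_div_two_pos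
    have hl : 0 < Real.log 2 := Real.log_pos one_lt_two
    have hrate : ∀ ε : ℝ, b / (Real.exp 1 * K₂ * ε) = b * (κ / ε) := by
      intro ε
      rw [hκ, div_div, mul_one_div]
    set C₁ := W * (M * K₁ + M ^ 2) * (4 * Real.exp 1 / Real.log 2) * κ with hC₁
    -- For `ε > ε₀` the error at order 1 is only `O(1 / ε)`; the last factor compensates the
    -- exponential, which is bounded below there.
    set C₂ := W * (M * K₁ * K₂ + (M * K₂) ^ 2) * Real.exp (b * (κ / ε₀)) with hC₂
    have hC₁0 : 0 ≤ C₁ := by positivity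
    have hC₂0 : 0 ≤ C₂ := by positivity
    refine ⟨C₁ + C₂ + 1, by positivity, fun ε hε φ₀ φ₁ φ h₀ h₁ hφ => ?_⟩
    have hε0 := hε.1
    rw [hrate]
    by_cases hc : ε ≤ ε₀
    · have hcI : ε ∈ Ioc 0 ε₀ := ⟨hε.1, hc⟩
      simp only [if_pos hc]
      refine (herr ε _ _ hε.1 hε.2.le (hZN ε hε.1 _ (hfloor ε hcI).2) (hDsmall ε hcI)
        (fun σ => h.norm_residual_le hξη hM hS ha0 hε.1 hε.2.le hq1.le (hfloor ε hcI).2 σ)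
        φ₀ φ₁ φ h₀ h₁ hφ).trans (ENNReal.ofReal_le_ofReal ?_)
      have hfl := floor_sq_mul_exp_le (hfloor ε hcI).1
      calc _ = W * (M * K₁ + M ^ 2) / ε *
              (((⌊κ / ε⌋₊ : ℝ) + 1) ^ 2 * Real.exp (-1) ^ ⌊κ / ε⌋₊) := by ring
        _ ≤ W * (M * K₁ + M ^ 2) / ε *
              (4 * Real.exp 1 / Real.log 2 * (κ / ε) * Real.exp (-(b * (κ / ε)))) := by gcongr
        _ = C₁ / ε ^ 2 * Real.exp (-(b * (κ / ε))) := by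
            rw [hC₁]
            field_simp
        _ ≤ _ := by
            gcongr
            linarith
    · have hc' : ε₀ < ε := not_le.1 hc
      simp only [if_neg hc]
      refine (herr ε _ _ hε.1 hε.2.le (hZ1N ε) (hDone ε)
        (fun σ => h.norm_residual_one_le hξη hM hS ha0 hε.1 hε.2.le σ)
        φ₀ φ₁ φ h₀ h₁ hφ).trans (ENNReal.ofReal_le_ofReal ?_)
      have e1 : 1 ≤ Real.exp (b * (κ / ε₀)) * Real.exp (-(b * (κ / ε))) := by
        rw [← Real.exp_add, ← sub_eq_add_neg]
        refine Real.one_le_exp (sub_nonneg.2 ?_)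
        gcongr
      have e2 : 1 / ε ≤ 1 / ε ^ 2 := by
        gcongr
        exact pow_le_of_le_one hε.1.le hε.2.le two_ne_zero
      calc _ = W * (M * K₁ * K₂ + (M * K₂) ^ 2) * (1 / ε) * 1 := by ring
        _ ≤ W * (M * K₁ * K₂ + (M * K₂) ^ 2) * (1 / ε ^ 2) *
              (Real.exp (b * (κ / ε₀)) * Real.exp (-(b * (κ / ε)))) := by gcongr
        _ = C₂ / ε ^ 2 * Real.exp (-(b * (κ / ε))) := by
            rw [hC₂]
            ring
        _ ≤ _ := by
            gcongr
            linarith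

end WKB

end

/-! ### Assembly: existence of admissible constants and the error bounds -/

theorem corollary3
    (ξ η : ℝ) (hξη : ξ < η)
    (a : ℝ → ℝ) (a₀ : ℝ) (ha₀ : 0 < a₀) (ha : ∀ x ∈ Icc ξ η, a₀ ≤ a x)
    -- `s` is the analytic extension of `S_0' = i √a` to the complex neighbourhood `G`
    (G : Set ℂ) (hG : IsOpen G) (hIG : ∀ x ∈ Icc ξ η, (x : ℂ) ∈ G)
    (s : ℂ → ℂ) (hs : DifferentiableOn ℂ s G)
    (hsI : ∀ x ∈ Icc ξ η, s (x : ℂ) = Complex.I * (Real.sqrt (a x) : ℂ))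
    (hsG : WKB.linftyNorm s G < ⊤) :
    (∃ K₁ K₂ : ℝ, WKB.SeriesBounds ξ η a (WKB.linftyNorm s G) K₁ K₂) ∧
    ∀ K₁ K₂ : ℝ, WKB.SeriesBounds ξ η a (WKB.linftyNorm s G) K₁ K₂ →
      ∃ N : ℝ → ℕ,
        -- the approximation of order `N ε` is well defined
        (∀ ε ∈ Ioo (0 : ℝ) 1, 1 ≤ N ε ∧ WKB.denom ξ η a ε (N ε) ≠ 0) ∧
        -- `N ε` is proportional to `1 / ε` (up to rounding) for small `ε`
        (∃ κ > (0 : ℝ), ∃ ε₀ ∈ Ioo (0 : ℝ) 1, ∀ ε ∈ Ioc (0 : ℝ) ε₀, N ε = ⌊κ / ε⌋₊) ∧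
        ∃ c > (0 : ℝ), ∀ R : ℝ, ∃ C₁ > (0 : ℝ), ∃ C₂ > (0 : ℝ), ∃ C₃ > (0 : ℝ),
          ∀ ε ∈ Ioo (0 : ℝ) 1, ∀ (φ₀ φ₁ : ℂ) (φ : ℝ → ℂ), ‖φ₀‖ ≤ R → ‖φ₁‖ ≤ R →
            WKB.IsSolution ξ η a ε φ₀ φ₁ φ →
              WKB.error ξ η a ε φ₀ φ₁ φ (N ε) ≤ ENNReal.ofReal
                (C₁ / ε * Real.exp (-(1 / (Real.exp 1 * K₂ * ε)))
                  + C₂ / ε ^ 2 *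
                    Real.exp (-(Real.log (Real.exp 1 / 2) / (Real.exp 1 * K₂ * ε)))) ∧
              WKB.optimalError ξ η a ε φ₀ φ₁ φ
                ≤ ENNReal.ofReal (C₃ / ε ^ 2 * Real.exp (-(c / ε))) := by
  have hT : IsCompact (Complex.ofReal '' Icc ξ η) :=
    isCompact_Icc.image Complex.continuous_ofReal
  have hTG : Complex.ofReal '' Icc ξ η ⊆ G := by
    rintro _ ⟨x, hx, rfl⟩
    exact hIG x hx
  -- Halving `√a₀` makes the inequality strict, hence an open condition that persists on a complex
  -- neighbourhood of the compact interval.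
  have hnorm : ∀ z ∈ Complex.ofReal '' Icc ξ η, √a₀ / 2 < ‖s z‖ := by
    rintro _ ⟨x, hx, rfl⟩
    rw [hsI x hx, norm_mul, Complex.norm_I, one_mul, Complex.norm_real,
      Real.norm_of_nonneg (Real.sqrt_nonneg _)]
    have h1 := Real.sqrt_le_sqrt (ha x hx)
    have h2 := Real.sqrt_pos.2 ha₀
    linarith
  obtain ⟨δ, hδ, hδG, hδs⟩ := WKB.exists_thickening_norm_ge hT hG hTG hs.continuousOn hnorm
  have hm : 0 < √a₀ / 2 := half_pos (Real.sqrt_pos.2 ha₀)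
  have hsM := WKB.norm_le_toReal_linftyNorm hG hs.continuousOn hsG
  have hM : WKB.linftyNorm s G = ENNReal.ofReal (WKB.linftyNorm s G).toReal :=
    (ENNReal.ofReal_toReal hsG.ne).symm
  have hS : ∀ σ n, ContDiffOn ℝ 1 (WKB.dSpm ξ η a σ n) (Icc ξ η) :=
    WKB.contDiffOn_dSpm hξη Metric.isOpen_thickening
      (fun x hx => Metric.self_subset_thickening hδ _ (mem_image_of_mem _ hx)) (hs.mono hδG)
      (fun z hz => norm_pos_iff.1 (hm.trans_le (hδs z hz))) hsI
  rw [hM]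
  refine ⟨WKB.exists_seriesBounds hξη hδ hm (hs.mono hδG) hδs (fun z hz => hsM z (hδG hz)) hsI,
    fun K₁ K₂ h => ?_⟩
  obtain ⟨N, hN, hκ, herr⟩ := WKB.exists_truncation hξη ha₀ ha ENNReal.toReal_nonneg hS h
  have h2 := h.pos₂
  have hlog := WKB.log_exp_one_div_two_pos
  refine ⟨N, hN, hκ, Real.log (Real.exp 1 / 2) / (Real.exp 1 * K₂), by positivity, fun R => ?_⟩
  obtain ⟨C, hC, hCerr⟩ := herr R
  -- The second exponential term alone bounds the error, so `C₁` may be any positive number, and the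
  -- same `C` serves the optimal truncation, whose error is at most that at `N ε`.
  refine ⟨1, one_pos, C, hC, C, hC, fun ε hε φ₀ φ₁ φ h₀ h₁ hφ => ⟨?_, ?_⟩⟩
  · refine (hCerr ε hε φ₀ φ₁ φ h₀ h₁ hφ).trans
      (ENNReal.ofReal_le_ofReal (le_add_of_nonneg_left ?_))
    have := hε.1
    positivity
  · rw [div_div]
    exact (iInf₂_le (N ε) (hN ε hε).2).trans (hCerr ε hε φ₀ φ₁ φ h₀ h₁ hφ)
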